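/- A linear circuit over a field $K$ with $n$ inputs and $n$ outputs is a finite directed acyclic graph with edges labelled by elements of $K$, with $n$ distinct input gates (of in-degree $0$) and $n$ designated output gates, in which every non-input gate computes the linear combination of its in-neighbours given by the labels of its incoming edges. Its size is its number of edges, and its depth is the maximal length of a path from an input gate to an output gate. It computes $M\in K^{n\times n}$ if on every input $x\in K^n$ the $i$-th output gate has value $(Mx)_i$. Theorem (Kumar--Volk). There are absolute constants $C,c,\delta>0$ such that the following holds. Let $\mathbb{F}_q$ be a finite field and let $d\ge 1$ be an integer. There is a family $(A_n)_{n\in\mathbb{N}}$, where $A_n$ is an $n\times n$ matrix with entries in a finite extension $\mathbb{E}_n=\mathbb{F}_q[z]/(g_n)$ of $\mathbb{F}_q$, with $g_n$ monic and irreducible, such that: 1. for all sufficiently large $n$, $[\mathbb{E}_n:\mathbb{F}_q]\le \exp\bigl(C\,n^{1-1/(2d)}\log n\bigr)$; 2. the family is constructible in time $\exp(n^{1-\Omega(1/d)})$: a single deterministic Turing machine (depending only on $\mathbb{F}_q$ and $d$), on input $n$ in unary, outputs the coefficients of $g_n$ and the coefficient vectors of all entries of $A_n$ (with respect to $1,z,z^2,\dots$),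 and its running time is at most $\exp(n^{1-c/d})$ for all sufficiently large $n$; 3. for all sufficiently large $n$ and every embedding $\mathbb{E}_n\hookrightarrow\overline{\mathbb{F}_q}$ over $\mathbb{F}_q$, every linear circuit over the algebraic closure $\overline{\mathbb{F}_q}$ of depth at most $d$ computing (the image of) $A_n$ has size at least $\delta\, n^{1+1/(2d)}$. Here "sufficiently large" may depend on $\mathbb{F}_q$ and $d$. -/

import Mathlib

/-- A linear circuit over `K` with `n` inputs and `n` outputs: a finite directed acyclic graph whose
edges carry labels in `K`, with `n` distinct input gates (no edge enters an input gate) and `n`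
designated output gates (not required to be distinct). Every gate that is not an input computes the
linear combination of its in-neighbours given by the labels of its incoming edges. -/
structure LinearCircuit (K : Type) [Field K] (n : ℕ) where
  /-- the gates -/
  Gate : Type
  /-- there are finitely many gates -/
  finiteGate : Finite Gate
  /-- the directed edges -/
  edges : Finset (Gate × Gate)
  /-- the labels of the edges (values outside `edges` are irrelevant) -/
  label : Gate × Gate → K
  /-- the input gates -/
  input : Fin n → Gate
  input_injective : Function.Injective input
  input_source : ∀ (i : Fin n) (u : Gate), (u, input i) ∉ edges
  /-- the output gates -/
  output : Fin n → Gate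
  acyclic : ∀ u : Gate, ¬ Relation.TransGen (fun a b => (a, b) ∈ edges) u u

namespace LinearCircuit

variable {K : Type} [Field K] {n : ℕ}

/-- The size of a linear circuit is its number of edges. -/
def size (C : LinearCircuit K n) : ℕ := C.edges.card

/-- `C.IsPath u v l`: there is a directed path with exactly `l` edges from `u` to `v`. -/
inductive IsPath (C : LinearCircuit K n) : C.Gate → C.Gate → ℕ → Prop
  | nil (u : C.Gate) : IsPath C u u 0
  | cons {u v w : C.Gate} {l : ℕ} :
      (u, v) ∈ C.edges → IsPath C v w l → IsPath C u w (l + 1)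

/-- The depth of `C` is at most `d`: no path from an input gate to an output gate has more than
`d` edges. -/
def DepthAtMost (C : LinearCircuit K n) (d : ℕ) : Prop :=
  ∀ (j i : Fin n) (l : ℕ), C.IsPath (C.input j) (C.output i) l → l ≤ d

open Classical in
/-- `v` assigns to every gate the value that it computes on the input vector `x`. -/
def IsEvaluation (C : LinearCircuit K n) (x : Fin n → K) (v : C.Gate → K) : Prop :=
  (∀ j, v (C.input j) = x j) ∧
    ∀ g, g ∉ Set.range C.input →
      v g = ∑ e ∈ C.edges with e.2 = g, C.label e * v e.1

/-- `C` computes the linear transformation `x ↦ M x`. -/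
def Computes (C : LinearCircuit K n) (M : Matrix (Fin n) (Fin n) K) : Prop :=
  ∀ x : Fin n → K, ∃ v : C.Gate → K, C.IsEvaluation x v ∧ ∀ i, v (C.output i) = M.mulVec x i

end LinearCircuit

/-- An `n × n` matrix over an explicitly presented finite extension `𝔼 = F[z] / (g)` of `F`,
with `g` monic and irreducible. -/
structure ExtensionMatrix (F : Type) [Field F] (n : ℕ) where
  /-- the defining polynomial `g` of the extension -/
  modulus : Polynomial F
  monic : modulus.Monic
  irreducible : Irreducible modulus
  /-- the entries of the matrix -/
  entries : Matrix (Fin n) (Fin n) (AdjoinRoot modulus)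

namespace ExtensionMatrix

variable {F : Type} [Field F] {n : ℕ}

/-- The extension `𝔼 = F[z] / (g)` in which the entries lie. -/
abbrev Ext (A : ExtensionMatrix F n) : Type := AdjoinRoot A.modulus

/-- The coefficients of `1, z, …, z ^ (k - 1)` in `p`, as a word. -/
def coeffWord (k : ℕ) (p : Polynomial F) : List (Option F) :=
  (List.range k).map fun m => some (p.coeff m)

/-- The explicit description of `A` as a word over the alphabet `F ∪ {separator}`, where `none` is
the separator: the coefficients of `g`, followed by the entries of `A` row by row, each entry being
given by the coefficient vector of the representative of degree less than `deg g`; a separator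
follows each of these vectors. -/
noncomputable def encode (A : ExtensionMatrix F n) : List (Option F) :=
  coeffWord (A.modulus.natDegree + 1) A.modulus ++ none ::
    (List.finRange n).flatMap fun i => (List.finRange n).flatMap fun j =>
      coeffWord A.modulus.natDegree (AdjoinRoot.modByMonicHom A.monic (A.entries i j)) ++ [none]

end ExtensionMatrix

/-- The family `A` of matrices is constructible in time `T`: a single deterministic (multi-stack)
Turing machine outputs the description of `A n` on input `n` in unary within `T n` steps,
for every `n`. -/
def ConstructibleInTime {F : Type} [Field F] (A : (n : ℕ) → ExtensionMatrix F n)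
    (T : ℕ → ℕ) : Prop :=
  ∃ M : Turing.TM2ComputableInTime Computability.unaryEncodeNat (id : List (Option F) → _)
      (fun n => (A n).encode), M.time = T

/-! Let V be the F-span of 1 and the labels of a circuit with s edges and depth at most d. An entry
of the computed matrix is a sum, over paths with at most d edges, of products of labels, so it lies
in V^d. Suppose the entries include z^(c Q^g) for all c < Q and g < T. Base-Q expansion writes every
z^x with x < Q^T as a product of T entries, so it lies in V^(dT), a space spanned by monomials in
the labels and of dimension at most binom(s + dT, dT). If z has degree at least Q^T over F, these
powers are independent, whence Q^T ≤ binom(s + dT, dT) (`LinearCircuit.Computes.pow_le_choose`).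

Take Q of order n^(1+1/(2d)) and T of order n^(1-1/(2d)), so that the QT exponents fit into n²
positions. If s < n^(1+1/(2d)), then s/T = O(n^(1/d)), and the binomial is at most (O(n^(1/d)))^(dT)
= O(n)^T, which is below Q^T for large n (`not_groupSize_pow_le_choose`).

The extension needs no search: over F there are a fixed prime r and a fixed polynomial f with all
f(X^(r^k)) irreducible (`exists_irreducible_expand_prime_pow`). With Q a power of r, the sparse
polynomial f(X^(Q^T)) serves as modulus, of degree deg f · Q^T = exp(O(n^(1-1/(2d)) log n)).

For constructibility, a program on unary counters writes the matrix. Its counters stay below a bound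
B of the same order as the degree, up to constants in the exponent, and it takes at most B^13 steps
(`runs_matrixProg`). The program is compiled to a stack machine with the same step count up to the
final halt (`exists_computableInTime`). -/

/-- A small imperative language over unary counters indexed by `ι`, with a write-only output over
the alphabet `S`. -/
inductive CounterProg (ι S : Type) : Type
  | skip : CounterProg ι S
  | inc : ι → CounterProg ι S
  | dec : ι → CounterProg ι S
  | emit : S → CounterProg ι S
  | seq : CounterProg ι S → CounterProg ι S → CounterProg ι S
  | loop : ι → CounterProg ι S → CounterProg ι S
  | ite : ι → CounterProg ι S → CounterProg ι S → CounterProg ι S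

/-! ### Counter programs and their compilation to stack machines. -/

namespace CounterProg

variable {ι S : Type}

/-- The control points of a program. -/
def Lbl : CounterProg ι S → Type
  | skip | inc _ | dec _ | emit _ => Unit
  | seq p q => Lbl p ⊕ Lbl q
  | loop _ p => Option (Lbl p)
  | ite _ p q => Option (Lbl p ⊕ Lbl q)

instance finite_lbl : (p : CounterProg ι S) → Finite (Lbl p)
  | skip | inc _ | dec _ | emit _ => inferInstanceAs (Finite Unit)
  | seq p q =>
    have := finite_lbl p
    have := finite_lbl q
    inferInstanceAs (Finite (Lbl p ⊕ Lbl q))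
  | loop _ p =>
    have := finite_lbl p
    inferInstanceAs (Finite (Option (Lbl p)))
  | ite _ p q =>
    have := finite_lbl p
    have := finite_lbl q
    inferInstanceAs (Finite (Option (Lbl p ⊕ Lbl q)))

/-- The control point at which the execution of a program starts. -/
def entry : (p : CounterProg ι S) → Lbl p
  | skip | inc _ | dec _ | emit _ => ()
  | seq p _ => Sum.inl (entry p)
  | loop _ _ => none
  | ite _ _ _ => none

/-- The stack alphabets: the output stack `none` carries `S`, the counters are unary. -/
abbrev Alph (ι S : Type) : Option ι → Type
  | none => S
  | some _ => Bool

open Turing.TM2.Stmt in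
/-- The stack machine statement at each control point; `i` embeds the control points into the labels
of the machine and `x` is the label at which execution continues afterwards. -/
def code {Λ : Type} : (p : CounterProg ι S) → (Lbl p → Λ) → Λ → Lbl p →
    Turing.TM2.Stmt (Alph ι S) Λ Bool
  | skip, _, x, _ => goto fun _ => x
  | inc k, _, x, _ => push (some k) (fun _ => (true : Bool)) (goto fun _ => x)
  | dec k, _, x, _ => pop (some k) (fun v _ => v) (goto fun _ => x)
  | emit a, _, x, _ => push none (fun _ => a) (goto fun _ => x)
  | seq p q, i, _, Sum.inl l => code p (fun l => i (Sum.inl l)) (i (Sum.inr (entry q))) l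
  | seq _ q, i, x, Sum.inr l => code q (fun l => i (Sum.inr l)) x l
  | loop k p, i, x, none => peek (some k) (fun _ o => o.isSome)
      (branch id (load (fun _ => false) (goto fun _ => i (some (entry p)))) (goto fun _ => x))
  | loop _ p, i, _, some l => code p (fun l => i (some l)) (i none) l
  | ite k p q, i, _, none => peek (some k) (fun _ o => o.isSome)
      (branch id (load (fun _ => false) (goto fun _ => i (some (Sum.inl (entry p)))))
        (goto fun _ => i (some (Sum.inr (entry q)))))
  | ite _ p _, i, x, some (Sum.inl l) => code p (fun l => i (some (Sum.inl l))) x l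
  | ite _ _ q, i, x, some (Sum.inr l) => code q (fun l => i (some (Sum.inr l))) x l

/-- Big-step semantics: `Runs p s o s' o' c` says that `p`, started with counters `s` and output
`o` (most recent symbol first), ends with `s'` and `o'` after at most `c` steps. -/
inductive Runs [DecidableEq ι] : CounterProg ι S → (ι → ℕ) → List S → (ι → ℕ) → List S → ℕ → Prop
  | skip (s o) : Runs skip s o s o 1
  | inc (k s o) : Runs (inc k) s o (Function.update s k (s k + 1)) o 1
  | dec (k s o) : Runs (dec k) s o (Function.update s k (s k - 1)) o 1
  | emit (a s o) : Runs (emit a) s o s (a :: o) 1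
  | seq {p q s₁ o₁ s₂ o₂ s₃ o₃ c c'} : Runs p s₁ o₁ s₂ o₂ c → Runs q s₂ o₂ s₃ o₃ c' →
      Runs (seq p q) s₁ o₁ s₃ o₃ (c + c')
  | loop_zero {k p s o} : s k = 0 → Runs (loop k p) s o s o 1
  | loop_succ {k p s₁ o₁ s₂ o₂ s₃ o₃ c c'} : s₁ k ≠ 0 → Runs p s₁ o₁ s₂ o₂ c →
      Runs (loop k p) s₂ o₂ s₃ o₃ c' → Runs (loop k p) s₁ o₁ s₃ o₃ (1 + c + c')
  | ite_zero {k p q s₁ o₁ s₂ o₂ c} : s₁ k = 0 → Runs q s₁ o₁ s₂ o₂ c →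
      Runs (ite k p q) s₁ o₁ s₂ o₂ (1 + c)
  | ite_succ {k p q s₁ o₁ s₂ o₂ c} : s₁ k ≠ 0 → Runs p s₁ o₁ s₂ o₂ c →
      Runs (ite k p q) s₁ o₁ s₂ o₂ (1 + c)
  | mono {p s₁ o₁ s₂ o₂ c c'} : Runs p s₁ o₁ s₂ o₂ c → c ≤ c' → Runs p s₁ o₁ s₂ o₂ c'

/-- The stacks that represent the counters `s` and the output `o`. -/
def toStk (s : ι → ℕ) (o : List S) : (k : Option ι) → List (Alph ι S k)
  | none => o
  | some k => List.replicate (s k) (true : Bool)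

variable [DecidableEq ι]

theorem update_toStk_some (s : ι → ℕ) (o : List S) (k : ι) (m : ℕ) :
    Function.update (toStk s o) (some k) (List.replicate m (true : Bool)) =
      toStk (Function.update s k m) o := by
  funext j
  rcases j with _ | j
  · rfl
  · by_cases h : j = k
    · subst h
      simp [toStk]
    · rw [Function.update_of_ne (by simpa using h)]
      simp [toStk, Function.update_of_ne h]

theorem update_toStk_none (s : ι → ℕ) (o o' : List S) :
    Function.update (toStk s o) none o' = toStk s o' := by
  funext j
  rcases j with _ | j
  · exact Function.update_self (β := fun k => List (Alph ι S k)) _ _ _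
  · exact Function.update_of_ne (β := fun k => List (Alph ι S k)) (by simp) _ _

/-- `n` steps of the machine `M` lead from `a` to `b`. -/
def StepsTo {Λ : Type} (M : Λ → Turing.TM2.Stmt (Alph ι S) Λ Bool) (n : ℕ)
    (a b : Turing.TM2.Cfg (Alph ι S) Λ Bool) : Prop :=
  (flip bind (Turing.TM2.step M))^[n] (some a) = some b

theorem StepsTo.trans {Λ : Type} {M : Λ → Turing.TM2.Stmt (Alph ι S) Λ Bool} {m n : ℕ}
    {a b c : Turing.TM2.Cfg (Alph ι S) Λ Bool} (h : StepsTo M m a b) (h' : StepsTo M n b c) :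
    StepsTo M (m + n) a c := by
  unfold StepsTo at *
  rw [add_comm, Function.iterate_add_apply, h, h']

theorem StepsTo.single {Λ : Type} {M : Λ → Turing.TM2.Stmt (Alph ι S) Λ Bool}
    {a b : Turing.TM2.Cfg (Alph ι S) Λ Bool} (h : Turing.TM2.step M a = some b) :
    StepsTo M 1 a b := h

/-- Correctness of the compilation to stack machines. -/
theorem Runs.exists_stepsTo {Λ : Type} {M : Λ → Turing.TM2.Stmt (Alph ι S) Λ Bool}
    {p : CounterProg ι S} {s s' : ι → ℕ} {o o' : List S} {c : ℕ} (h : Runs p s o s' o' c) :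
    ∀ (i : Lbl p → Λ) (x : Λ), (∀ l, M (i l) = code p i x l) →
      ∃ m ≤ c, StepsTo M m ⟨some (i (entry p)), false, toStk s o⟩
        ⟨some x, false, toStk s' o'⟩ := by
  induction h with
  | skip s o =>
    intro i x hM
    refine ⟨1, le_rfl, StepsTo.single ?_⟩
    simp [hM, code]
  | inc k s o =>
    intro i x hM
    refine ⟨1, le_rfl, StepsTo.single ?_⟩
    simp only [Turing.TM2.step, hM, code, Turing.TM2.stepAux]
    rw [← update_toStk_some]
    rfl
  | dec k s o =>
    intro i x hM
    refine ⟨1, le_rfl, StepsTo.single ?_⟩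
    simp only [Turing.TM2.step, hM, code, Turing.TM2.stepAux]
    rw [← update_toStk_some]
    simp only [toStk, List.tail_replicate]
  | emit a s o =>
    intro i x hM
    refine ⟨1, le_rfl, StepsTo.single ?_⟩
    simp only [Turing.TM2.step, hM, code, Turing.TM2.stepAux]
    rw [← update_toStk_none s o (a :: o)]
    rfl
  | @seq p q s₁ o₁ s₂ o₂ s₃ o₃ c c' _ _ ih₁ ih₂ =>
    intro i x hM
    obtain ⟨m₁, hm₁, h₁⟩ := ih₁ (fun l => i (Sum.inl l)) (i (Sum.inr (entry q)))
      (fun l => hM (Sum.inl l))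
    obtain ⟨m₂, hm₂, h₂⟩ := ih₂ (fun l => i (Sum.inr l)) x (fun l => hM (Sum.inr l))
    exact ⟨m₁ + m₂, by omega, h₁.trans h₂⟩
  | @loop_zero k p s o hk =>
    intro i x hM
    refine ⟨1, le_rfl, StepsTo.single ?_⟩
    have := hM none
    simp [Turing.TM2.step, entry, this, code, Turing.TM2.stepAux, toStk, hk]
  | @loop_succ k p s₁ o₁ s₂ o₂ s₃ o₃ c c' hk _ _ ih₁ ih₂ =>
    intro i x hM
    obtain ⟨m₁, hm₁, h₁⟩ := ih₁ (fun l => i (some l)) (i none) (fun l => hM (some l))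
    obtain ⟨m₂, hm₂, h₂⟩ := ih₂ i x hM
    refine ⟨1 + m₁ + m₂, by omega, (StepsTo.trans (StepsTo.single ?_) h₁).trans h₂⟩
    have := hM none
    obtain ⟨j, hj⟩ := Nat.exists_eq_succ_of_ne_zero hk
    -- The test leaves `true` in the machine's state; the `load` resets it, so every control point
    -- is entered with state `false`.
    simp [Turing.TM2.step, entry, this, code, Turing.TM2.stepAux, toStk, hj]
    rfl
  | @ite_zero k p q s₁ o₁ s₂ o₂ c hk _ ih =>
    intro i x hM
    obtain ⟨m₁, hm₁, h₁⟩ := ih (fun l => i (some (Sum.inr l))) x (fun l => hM (some (Sum.inr l)))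
    refine ⟨1 + m₁, by omega, StepsTo.trans (StepsTo.single ?_) h₁⟩
    have := hM none
    simp [Turing.TM2.step, entry, this, code, Turing.TM2.stepAux, toStk, hk]
  | @ite_succ k p q s₁ o₁ s₂ o₂ c hk _ ih =>
    intro i x hM
    obtain ⟨m₁, hm₁, h₁⟩ := ih (fun l => i (some (Sum.inl l))) x (fun l => hM (some (Sum.inl l)))
    refine ⟨1 + m₁, by omega, StepsTo.trans (StepsTo.single ?_) h₁⟩
    have := hM none
    obtain ⟨j, hj⟩ := Nat.exists_eq_succ_of_ne_zero hk
    simp [Turing.TM2.step, entry, this, code, Turing.TM2.stepAux, toStk, hj]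
    rfl
  | mono _ hc ih =>
    intro i x hM
    obtain ⟨m, hm, h⟩ := ih i x hM
    exact ⟨m, hm.trans hc, h⟩

/-- The stack machine that executes `p` and halts; its input is the counter `k`. -/
noncomputable def toFinTM2 [Fintype ι] (p : CounterProg ι S) (k : ι) : Turing.FinTM2 where
  K := Option ι
  k₀ := some k
  k₁ := none
  Γ := Alph ι S
  Λ := Option (Lbl p)
  main := some (entry p)
  ΛFin := Fintype.ofFinite _
  σ := Bool
  initialState := false
  Γk₀Fin := inferInstanceAs (Fintype Bool)
  m
    | none => Turing.TM2.Stmt.halt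
    | some l => code p some none l

theorem unaryEncodeNat_eq_replicate (n : ℕ) :
    Computability.unaryEncodeNat n = List.replicate n true := by
  induction n with
  | zero => rfl
  | succ n ih => rw [Computability.unaryEncodeNat, ih, List.replicate_succ]

/-- A program that, started with `n` in the counter `k`, writes `f n` and resets all counters within
`T n` steps, witnesses that `f` is computable in time `T`. -/
theorem exists_computableInTime [Fintype ι] (p : CounterProg ι S) (k : ι) (f : ℕ → List S)
    (T : ℕ → ℕ)
    (h : ∀ n, Runs p (Function.update (fun _ => 0) k n) [] (fun _ => 0) (f n) (T n)) :
    ∃ M : Turing.TM2ComputableInTime Computability.unaryEncodeNat (id : List S → _) f,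
      M.time = fun n => T n + 1 := by
  have key : ∀ n, ∃ m ≤ T n + 1, (flip bind (toFinTM2 p k).step)^[m]
      (some (Turing.initList (toFinTM2 p k)
        (List.map (Equiv.refl Bool).invFun (Computability.unaryEncodeNat n)))) =
      some (Turing.haltList (toFinTM2 p k) (List.map (Equiv.refl S).invFun (f n))) := by
    intro n
    obtain ⟨m, hm, hs⟩ := (h n).exists_stepsTo (M := (toFinTM2 p k).m) some none (fun _ => rfl)
    -- The additional step executes `halt` at the label `none`.
    refine ⟨m + 1, by omega, ?_⟩
    have h1 : StepsTo (toFinTM2 p k).m 1 ⟨some none, false, toStk (fun _ => 0) (f n)⟩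
        ⟨none, false, toStk (fun _ => 0) (f n)⟩ := rfl
    have h2 := hs.trans h1
    unfold StepsTo at h2
    have e1 : Turing.initList (toFinTM2 p k)
        (List.map (Equiv.refl Bool).invFun (Computability.unaryEncodeNat n)) =
        ⟨some (some (entry p)), false, toStk (Function.update (fun _ => 0) k n) []⟩ := by
      unfold Turing.initList
      congr 1
      funext j
      rcases j with _ | j
      · rw [dif_neg (by simp [toFinTM2])]
        rfl
      · by_cases hj : j = k
        · subst hj
          refine (dif_pos rfl).trans ?_
          simp only [toStk, Function.update_self, unaryEncodeNat_eq_replicate]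
          exact List.map_id _
        · rw [dif_neg (by simpa [toFinTM2] using hj)]
          simp only [toStk, Function.update_of_ne hj]
          rfl
    have e2 : Turing.haltList (toFinTM2 p k) (List.map (Equiv.refl S).invFun (f n)) =
        ⟨none, false, toStk (fun _ => 0) (f n)⟩ := by
      unfold Turing.haltList
      congr 1
      funext j
      rcases j with _ | j
      · exact (dif_pos rfl).trans (List.map_id _)
      · rw [dif_neg (by simp [toFinTM2])]
        rfl
    rw [e1, e2]
    exact h2
  have hl : ∀ n, (Computability.unaryEncodeNat n).length = n := fun n => by
    simp [unaryEncodeNat_eq_replicate]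
  exact ⟨{
    tm := toFinTM2 p k
    inputAlphabet := Equiv.refl Bool
    outputAlphabet := Equiv.refl S
    time := fun n => T n + 1
    outputsFun := fun n =>
      { steps := (key n).choose
        evals_in_steps := (key n).choose_spec.2
        steps_le_m := by
          rw [hl]
          exact (key n).choose_spec.1 } }, rfl⟩

end CounterProg

/-! ### Macros, registers, and costs measured in powers of a counter bound. -/

namespace CounterProg

section Macros

variable {ι S : Type} [DecidableEq ι]

/-- Increment the counters in the list, with multiplicity. -/
def incs (l : List ι) : CounterProg ι S := l.foldr (fun k p => seq (inc k) p) skip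

/-- Empty the counter `a`, adding its value to each counter in the list, with multiplicity. -/
def move (a : ι) (l : List ι) : CounterProg ι S := loop a (seq (dec a) (incs l))

/-- Like `move`, emitting the symbol `w` once for each unit. -/
def moveEmit (a : ι) (l : List ι) (w : S) : CounterProg ι S :=
  loop a (seq (dec a) (seq (incs l) (emit w)))

/-- Reset the counters in the list. -/
def clear (l : List ι) : CounterProg ι S := l.foldr (fun k p => seq (move k []) p) skip

theorem Runs.of_eq {p : CounterProg ι S} {s t s' t' : ι → ℕ} {o w o' w' : List S} {c c' : ℕ}
    (h : Runs p s o s' o' c) (hs : ∀ k, t k = s k) (hs' : ∀ k, t' k = s' k) (ho : w = o)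
    (ho' : w' = o') (hc : c ≤ c') : Runs p t w t' w' c' := by
  rw [funext hs, funext hs', ho, ho']
  exact h.mono hc

theorem Runs.incs (l : List ι) (s : ι → ℕ) (o : List S) :
    Runs (CounterProg.incs l) s o (fun k => s k + l.count k) o (l.length + 1) := by
  induction l generalizing s with
  | nil => exact .skip s o
  | cons a l ih =>
    refine .mono (.seq (.inc a s o) (?_ : Runs _ _ _ _ _ (l.length + 1))) (by simp; omega)
    refine (ih _).of_eq (fun _ => rfl) (fun k => ?_) rfl rfl le_rfl
    by_cases h : k = a
    · subst h
      simp
      omega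
    · simp [Function.update_of_ne h, Ne.symm h]

/-- The rule for a counting loop whose intermediate states are known. -/
theorem Runs.loop_of_forall {k : ι} {p : CounterProg ι S} (σ : ℕ → ι → ℕ) (ω : ℕ → List S)
    (N c : ℕ) (hk : ∀ i ≤ N, σ i k = N - i)
    (h : ∀ i < N, Runs p (σ i) (ω i) (σ (i + 1)) (ω (i + 1)) c) :
    Runs (CounterProg.loop k p) (σ 0) (ω 0) (σ N) (ω N) (N * (c + 1) + 1) := by
  have key : ∀ j ≤ N, Runs (CounterProg.loop k p) (σ (N - j)) (ω (N - j)) (σ N) (ω N)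
      (j * (c + 1) + 1) := by
    intro j
    induction j with
    | zero =>
      intro _
      simpa using Runs.loop_zero (p := p) (o := ω N) (by simpa using hk N le_rfl)
    | succ j ih =>
      intro hj
      have h1 := h (N - (j + 1)) (by omega)
      rw [show N - (j + 1) + 1 = N - j by omega] at h1
      have h0 : σ (N - (j + 1)) k ≠ 0 := by
        rw [hk _ (by omega)]
        omega
      refine .mono (.loop_succ h0 h1 (ih (by omega))) ?_
      rw [Nat.succ_mul]
      omega
  simpa using key N le_rfl

theorem Runs.move (a : ι) (l : List ι) (ha : a ∉ l) (s : ι → ℕ) (o : List S) :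
    Runs (CounterProg.move a l) s o (fun k => if k = a then 0 else s k + s a * l.count k) o
      (s a * (l.length + 3) + 1) := by
  have := Runs.loop_of_forall (k := a) (p := CounterProg.seq (CounterProg.dec a)
    (CounterProg.incs l)) (fun i k => if k = a then s a - i else s k + i * l.count k)
    (fun _ => o) (s a) (l.length + 2) (by simp) (by
      intro i _
      refine .mono (.seq (.dec a _ o) (?_ : Runs _ _ _ _ _ (l.length + 1))) (by omega)
      refine (Runs.incs l _ o).of_eq (fun _ => rfl) (fun k => ?_) rfl rfl le_rfl
      by_cases h : k = a
      · subst h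
        simp [List.count_eq_zero_of_not_mem ha]
        omega
      · simp [h]
        ring)
  refine this.of_eq (fun k => ?_) (fun k => ?_) rfl rfl le_rfl <;>
    by_cases h : k = a <;> simp [h]

theorem Runs.moveEmit (a : ι) (l : List ι) (w : S) (ha : a ∉ l) (s : ι → ℕ) (o : List S) :
    Runs (CounterProg.moveEmit a l w) s o
      (fun k => if k = a then 0 else s k + s a * l.count k) (List.replicate (s a) w ++ o)
      (s a * (l.length + 4) + 1) := by
  have := Runs.loop_of_forall (k := a) (p := CounterProg.seq (CounterProg.dec a)
    (CounterProg.seq (CounterProg.incs l) (CounterProg.emit w)))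
    (fun i k => if k = a then s a - i else s k + i * l.count k)
    (fun i => List.replicate i w ++ o) (s a) (l.length + 3) (by simp) (by
      intro i _
      refine .mono (.seq (.dec a _ _) (.seq (Runs.incs l _ _) ?_))
        (by omega : 1 + (l.length + 1 + 1) ≤ _)
      refine (Runs.emit w _ _).of_eq (fun _ => rfl) (fun k => ?_) rfl
        (by rw [List.replicate_succ, List.cons_append]) le_rfl
      by_cases h : k = a
      · subst h
        simp [List.count_eq_zero_of_not_mem ha]
        omega
      · simp [h]
        ring)
  refine this.of_eq (fun k => ?_) (fun k => ?_) (by simp) rfl le_rfl <;>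
    by_cases h : k = a <;> simp [h]

theorem Runs.clear (l : List ι) (s : ι → ℕ) (o : List S) (B : ℕ) (hs : ∀ k, s k ≤ B) :
    Runs (CounterProg.clear l) s o (fun k => if k ∈ l then 0 else s k) o
      (l.length * (B * 3 + 1) + 1) := by
  induction l generalizing s with
  | nil => exact (Runs.skip s o).of_eq (fun _ => rfl) (fun k => by simp) rfl rfl (by simp)
  | cons a l ih =>
    refine .mono (.seq (Runs.move a [] (by simp) s o)
      (?_ : Runs _ _ _ _ _ (l.length * (B * 3 + 1) + 1))) ?_
    · refine (ih _ (fun k => ?_)).of_eq (fun _ => rfl) (fun k => ?_) rfl rfl le_rfl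
      · split_ifs
        · exact Nat.zero_le _
        · simpa using hs k
      · by_cases h : k = a <;> simp [h]
    · have := hs a
      simp only [List.length_nil, List.length_cons, Nat.succ_mul]
      omega

end Macros

/-- The counters of the matrix-constructing program. -/
inductive Reg
  | n | row | col | z | u | t | q | s | p | e | deg | R | x | y
  deriving DecidableEq

instance : Fintype Reg where
  elems := {.n, .row, .col, .z, .u, .t, .q, .s, .p, .e, .deg, .R, .x, .y}
  complete k := by cases k <;> decide

/-- The values of the counters. -/
structure Regs where
  (n row col z u t q s p e deg R x y : ℕ)

/-- The value of a single counter. -/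
def Regs.get (v : Regs) : Reg → ℕ
  | .n => v.n
  | .row => v.row
  | .col => v.col
  | .z => v.z
  | .u => v.u
  | .t => v.t
  | .q => v.q
  | .s => v.s
  | .p => v.p
  | .e => v.e
  | .deg => v.deg
  | .R => v.R
  | .x => v.x
  | .y => v.y

variable {S : Type}

/-- The cost is quadratic in B and is rounded up to a pure power. The target state is a free record,
so that it can be checked register by register. -/
theorem runs_move {a : Reg} {l : List Reg} {v v' : Regs} {o : List S} {B : ℕ}
    (hv' : ∀ k, v'.get k = if k = a then 0 else v.get k + v.get a * l.count k)
    (ha : a ∉ l) (hl : l.length ≤ B) (hB : 20 ≤ B) (h : v.get a ≤ B) :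
    Runs (move a l) v.get o v'.get o (B ^ 3) := by
  rw [show v'.get = _ from funext hv']
  refine (Runs.move a l ha v.get o).mono ?_
  calc v.get a * (l.length + 3) + 1 ≤ B * (B + 3) + 1 := by gcongr
    _ ≤ B ^ 3 := by nlinarith [Nat.mul_le_mul hB (Nat.mul_le_mul hB hB)]

theorem runs_moveEmit {a : Reg} {l : List Reg} {w : S} {v v' : Regs} {o o' : List S} {B : ℕ}
    (hv' : ∀ k, v'.get k = if k = a then 0 else v.get k + v.get a * l.count k)
    (ho' : o' = List.replicate (v.get a) w ++ o)
    (ha : a ∉ l) (hl : l.length ≤ B) (hB : 20 ≤ B) (h : v.get a ≤ B) :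
    Runs (moveEmit a l w) v.get o v'.get o' (B ^ 3) := by
  rw [show v'.get = _ from funext hv', ho']
  refine (Runs.moveEmit a l w ha v.get o).mono ?_
  calc v.get a * (l.length + 4) + 1 ≤ B * (B + 4) + 1 := by gcongr
    _ ≤ B ^ 3 := by nlinarith [Nat.mul_le_mul hB (Nat.mul_le_mul hB hB)]

theorem runs_dec {a : Reg} {v v' : Regs} {o : List S}
    (hv' : ∀ k, v'.get k = if k = a then v.get a - 1 else v.get k) :
    Runs (dec a) v.get o v'.get o 1 := by
  refine (Runs.dec a v.get o).of_eq (fun _ => rfl) (fun k => ?_) rfl rfl le_rfl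
  rw [hv']
  by_cases h : k = a <;> simp [h]

theorem runs_incs {l : List Reg} {v v' : Regs} {o : List S}
    (hv' : ∀ k, v'.get k = v.get k + l.count k) :
    Runs (incs l) v.get o v'.get o (l.length + 1) := by
  rw [show v'.get = _ from funext hv']
  exact Runs.incs l v.get o

/-- One extra factor B pays for the iterations and another for the overhead of the tests. -/
theorem runs_loop {k : Reg} {p : CounterProg Reg S} (σ : ℕ → Regs) (ω : ℕ → List S)
    {v v' : Regs} {o o' : List S} {N B c : ℕ} (hv : v = σ 0) (ho : o = ω 0) (hv' : v' = σ N)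
    (ho' : o' = ω N) (hB : 20 ≤ B) (hN : N ≤ B) (hk : ∀ i ≤ N, (σ i).get k = N - i)
    (h : ∀ i < N, Runs p (σ i).get (ω i) (σ (i + 1)).get (ω (i + 1)) (B ^ c)) :
    Runs (loop k p) v.get o v'.get o' (B ^ (c + 2)) := by
  subst hv ho hv' ho'
  refine (Runs.loop_of_forall (fun i => (σ i).get) ω N _ hk h).mono ?_
  have h1 : 1 ≤ B ^ c := Nat.one_le_pow _ _ (by omega)
  calc N * (B ^ c + 1) + 1 ≤ B * (B ^ c + B ^ c) + B ^ c := by gcongr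
    _ = B ^ c * (2 * B + 1) := by ring
    _ ≤ B ^ c * B ^ 2 := Nat.mul_le_mul_left _ (by nlinarith)
    _ = B ^ (c + 2) := by ring

/-- Since B ≥ 20, a sequence of up to twenty pieces of cost B^c, including constant-time pieces,
fits into B^(c+1). -/
theorem pow_step {B : ℕ} (hB : 20 ≤ B) (c c' : ℕ) (h : c + 1 = c' := by rfl) :
    1 ≤ B ^ c ∧ 20 * B ^ c ≤ B ^ c' := by
  subst h
  exact ⟨Nat.one_le_pow _ _ (by omega), by rw [pow_succ, mul_comm]; exact Nat.mul_le_mul_left _ hB⟩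

end CounterProg

/-! ### Computing the parameters and the degree. -/

namespace CounterProg

variable {S : Type}

open List (replicate)

/-- Multiply `u`, `t`, `q` by `b`, `τ`, `κ` and restart the countdown `z`. -/
def scale (b τ κ : ℕ) : CounterProg Reg S :=
  seq (move .u [.x]) <| seq (move .x (replicate b .u ++ replicate (b * (b - 1)) .z)) <|
  seq (move .t [.x]) <| seq (move .x (replicate τ .t)) <|
  seq (move .q [.x]) (move .x (replicate κ .q))

theorem runs_scale {b τ κ B : ℕ} (hB : 20 ≤ B) (hb : b + b * (b - 1) ≤ B) (hτ : τ ≤ B) (hκ : κ ≤ B)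
    {v : Regs} {o : List S} (hx : v.x = 0) (hu : v.u ≤ B) (ht : v.t ≤ B) (hq : v.q ≤ B) :
    Runs (scale b τ κ) v.get o ({ v with
      u := v.u * b, z := v.z + v.u * (b * (b - 1)), t := v.t * τ, q := v.q * κ } : Regs).get o
      (B ^ 4) := by
  have hc := pow_step hB 3 4
  refine .mono (.seq (runs_move (v' := { v with u := 0, x := v.u }) (B := B) ?_ (by simp)
    (by simp; omega) hB hu) <|
    .seq (runs_move (v' := { v with u := v.u * b, z := v.z + v.u * (b * (b - 1)) }) (B := B) ?_
    (by simp) (by simpa using hb) hB hu) <|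
    .seq (runs_move (v' := { v with
      u := v.u * b, z := v.z + v.u * (b * (b - 1)), t := 0, x := v.t }) (B := B) ?_ (by simp)
    (by simp; omega) hB ht) <|
    .seq (runs_move (v' := { v with
      u := v.u * b, z := v.z + v.u * (b * (b - 1)), t := v.t * τ }) (B := B) ?_ (by simp)
    (by simpa using hτ) hB ht) <|
    .seq (runs_move (v' := { v with
      u := v.u * b, z := v.z + v.u * (b * (b - 1)), t := v.t * τ, q := 0, x := v.q })
      (B := B) ?_ (by simp) (by simp; omega) hB hq) <|
    (runs_move (B := B) ?_ (by simp) (by simpa using hκ) hB hq))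
    (by omega) <;>
  · intro k
    cases k <;> simp [Regs.get, List.count_replicate, hx]

/-- From the input `n`, compute `u = b ^ j`, `t = τ ^ j` and `q = κ ^ j`, where `j` is the integer
part of the logarithm of `n` to the base `b`. -/
def params (b τ κ : ℕ) : CounterProg Reg S :=
  seq (incs (.u :: .t :: .q :: replicate b .z)) <|
  loop .n <| seq (dec .n) <| seq (incs [.row, .col]) <| seq (dec .z) <| ite .z skip (scale b τ κ)

/-- Counting i up to N, the register `z` holds the distance from i to the next power of b. When it
reaches 0 the integer logarithm increases, and only then are `u`, `t`, `q` multiplied. -/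
theorem runs_params {b τ κ B N : ℕ} (hB : 20 ≤ B) (hb2 : 2 ≤ b) (hb : b + b * (b - 1) ≤ B)
    (hτ : τ ≤ B) (hκ : κ ≤ B) (hτ1 : 1 ≤ τ) (hκ1 : 1 ≤ κ) (hN : N ≤ B)
    (hu : b ^ Nat.log b N ≤ B) (ht : τ ^ Nat.log b N ≤ B) (hq : κ ^ Nat.log b N ≤ B)
    {o : List S} :
    Runs (params b τ κ) (Regs.mk N 0 0 0 0 0 0 0 0 0 0 0 0 0).get o
      (Regs.mk 0 N N (b ^ (Nat.log b N + 1) - N) (b ^ Nat.log b N) (τ ^ Nat.log b N)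
        (κ ^ Nat.log b N) 0 0 0 0 0 0 0).get o (B ^ 8) := by
  refine .mono (.seq (runs_incs (v' := Regs.mk N 0 0 b 1 1 1 0 0 0 0 0 0 0) ?_)
    (runs_loop (fun i => Regs.mk (N - i) i i (b ^ (Nat.log b i + 1) - i) (b ^ Nat.log b i)
      (τ ^ Nat.log b i) (κ ^ Nat.log b i) 0 0 0 0 0 0 0) (fun _ => o) (B := B) (c := 5) ?_ rfl ?_ rfl
      hB hN ?_ ?_)) ?_
  · intro k
    cases k <;> simp [Regs.get, List.count_replicate]
  · simp
  · simp
  · intro i _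
    rfl
  · intro i hi
    set J := Nat.log b i with hJ
    have hmono : J ≤ Nat.log b N := Nat.log_mono_right hi.le
    have hlt : i < b ^ (J + 1) := Nat.lt_pow_succ_log_self hb2 i
    have h1 := pow_step hB 4 5
    refine .mono (.seq (runs_dec (v' := Regs.mk (N - (i + 1)) i i (b ^ (J + 1) - i) (b ^ J) (τ ^ J)
      (κ ^ J) 0 0 0 0 0 0 0) ?_) <|
      .seq (runs_incs (v' := Regs.mk (N - (i + 1)) (i + 1) (i + 1) (b ^ (J + 1) - i) (b ^ J) (τ ^ J)
      (κ ^ J) 0 0 0 0 0 0 0) ?_) <|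
      .seq (runs_dec (v' := Regs.mk (N - (i + 1)) (i + 1) (i + 1) (b ^ (J + 1) - (i + 1)) (b ^ J)
      (τ ^ J) (κ ^ J) 0 0 0 0 0 0 0) ?_)
      (?_ : Runs _ _ _ _ _ (1 + B ^ 4))) ?_
    · intro k
      cases k <;> simp [Regs.get]
      omega
    · intro k
      cases k <;> simp [Regs.get]
    · intro k
      cases k <;> simp [Regs.get]
      omega
    · by_cases hz : i + 1 = b ^ (J + 1)
      · have hJ' : Nat.log b (i + 1) = J + 1 := by rw [hz, Nat.log_pow hb2]
        refine .ite_zero (by simp [Regs.get, hz]) ?_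
        have hle : ∀ {x y : ℕ}, 1 ≤ x → x ^ Nat.log b N ≤ y → x ^ J ≤ y := fun hx hy =>
          (Nat.pow_le_pow_right hx hmono).trans hy
        refine (runs_scale hB hb hτ hκ rfl (hle (by omega) hu) (hle hτ1 ht) (hle hκ1 hq)).of_eq
          (fun _ => rfl) (fun k => ?_) rfl rfl le_rfl
        -- The new countdown b^(J+2) - b^(J+1) is a constant multiple of the old `u` = b^J, which is
        -- the reason for keeping `u`.
        have hz' : b ^ (J + 1 + 1) - (i + 1) = b ^ J * (b * (b - 1)) := by
          rw [hz, pow_succ b (J + 1), pow_succ b J, ← mul_assoc, Nat.mul_sub, mul_one]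
        rw [hJ', hz']
        cases k <;> simp [Regs.get, hz, pow_succ]
      · have hJ' : Nat.log b (i + 1) = J := by
          apply le_antisymm
          · exact Nat.lt_succ_iff.mp (Nat.log_lt_of_lt_pow (by omega) (lt_of_le_of_ne hlt hz))
          · exact Nat.log_mono_right (by omega)
        refine .ite_succ ?_ ((Runs.skip _ _).of_eq (fun _ => rfl) (fun k => ?_) rfl rfl h1.1)
        · simp [Regs.get]
          omega
        · rw [hJ']
    · simp
      omega
  · have : b ≤ B := by omega
    have h1 := pow_step hB 7 8
    have h0 : B ≤ B ^ 7 := Nat.le_self_pow (by omega) B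
    simp
    omega

/-- Compute `R = q ^ t` and `deg = m * R`, and set `p = 1`. -/
def powers (m : ℕ) : CounterProg Reg S :=
  seq (incs [.p]) <|
  seq (loop .t <| seq (dec .t) <| seq (incs [.y]) <| seq (move .p [.x]) <|
    loop .x <| seq (dec .x) <| seq (move .q [.s, .p]) (move .s [.q])) <|
  seq (move .y [.t]) <| seq (move .p (.R :: replicate m .deg)) (incs [.p])

/-- `p` is multiplied by `q` once per unit of `t`, by adding `q` for each unit of the old `p`. The
register `s` saves `q` and `y` saves `t`; the hypothesis q ≥ 1 bounds the intermediate powers by the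
last one. -/
theorem runs_powers {m B : ℕ} (hB : 20 ≤ B) (hm : m + 1 ≤ B) {v : Regs} {o : List S}
    (hp : v.p = 0) (hx : v.x = 0) (hy : v.y = 0) (hs : v.s = 0) (hR : v.R = 0) (hdeg : v.deg = 0)
    (ht : v.t ≤ B) (hq1 : 1 ≤ v.q) (hq : v.q ≤ B) (hP : v.q ^ v.t ≤ B) :
    Runs (powers m) v.get o
      ({ v with p := 1, R := v.q ^ v.t, deg := m * v.q ^ v.t } : Regs).get o (B ^ 12) := by
  obtain ⟨n, row, col, z, u, t, q, s, p, e, deg, R, x, y⟩ := v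
  simp only at *
  subst hp hx hy hs hR hdeg
  refine .mono (.seq (runs_incs (v' := Regs.mk n row col z u t q 0 1 e 0 0 0 0) ?_) <|
    .seq (runs_loop (v' := Regs.mk n row col z u 0 q 0 (q ^ t) e 0 0 0 t)
      (fun i => Regs.mk n row col z u (t - i) q 0 (q ^ i) e 0 0 0 i) (fun _ => o) (B := B) (c := 7)
      ?_ rfl ?_ rfl hB ht ?_ ?_) <|
    .seq (runs_move (v' := Regs.mk n row col z u t q 0 (q ^ t) e 0 0 0 0) (B := B) ?_ (by simp)
      (by simp; omega) hB ht) <|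
    .seq (runs_move (v' := Regs.mk n row col z u t q 0 0 e (m * q ^ t) (q ^ t) 0 0) (B := B) ?_
      (by simp) (by simpa using hm) hB hP)
      (runs_incs (v' := Regs.mk n row col z u t q 0 1 e (m * q ^ t) (q ^ t) 0 0) ?_)) ?_
  · intro k
    cases k <;> simp [Regs.get]
  · simp
  · simp
  · intro i _
    rfl
  · intro i hi
    have hqi : q ^ i ≤ B := (Nat.pow_le_pow_right hq1 hi.le).trans hP
    refine .mono (.seq (runs_dec (v' := Regs.mk n row col z u (t - (i + 1)) q 0 (q ^ i) e 0 0 0 i)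
        ?_) <|
      .seq (runs_incs (v' := Regs.mk n row col z u (t - (i + 1)) q 0 (q ^ i) e 0 0 0 (i + 1)) ?_) <|
      .seq (runs_move (v' := Regs.mk n row col z u (t - (i + 1)) q 0 0 e 0 0 (q ^ i) (i + 1))
        (B := B) ?_ (by simp) (by simp; omega) hB hqi) <|
      (runs_loop (fun i' => Regs.mk n row col z u (t - (i + 1)) q 0 (i' * q) e 0 0 (q ^ i - i')
        (i + 1)) (fun _ => o) (B := B) (c := 4) ?_ rfl ?_ rfl hB hqi ?_ ?_)) ?_
    · intro k
      cases k <;> simp [Regs.get]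
      omega
    · intro k
      cases k <;> simp [Regs.get]
    · intro k
      cases k <;> simp [Regs.get]
    · simp
    · simp [pow_succ]
    · intro i _
      rfl
    · intro i' hi'
      refine .mono (.seq (runs_dec (v' := Regs.mk n row col z u (t - (i + 1)) q 0 (i' * q) e 0 0
          (q ^ i - (i' + 1)) (i + 1)) ?_) <|
        .seq (runs_move (v' := Regs.mk n row col z u (t - (i + 1)) 0 q ((i' + 1) * q) e 0 0
          (q ^ i - (i' + 1)) (i + 1)) (B := B) ?_ (by simp) (by simp; omega) hB hq)
        (runs_move (B := B) ?_ (by simp) (by simp; omega) hB hq)) ?_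
      · intro k
        cases k <;> simp [Regs.get]
        omega
      · intro k
        cases k <;> simp [Regs.get, add_mul]
      · intro k
        cases k <;> simp [Regs.get]
      · have := pow_step hB 3 4
        omega
    · have h3 := pow_step hB 3 4
      have h4 := pow_step hB 4 5
      have h5 := pow_step hB 5 6
      have h6 := pow_step hB 6 7
      simp
      omega
  · intro k
    cases k <;> simp [Regs.get]
  · intro k
    cases k <;> simp [Regs.get, List.count_replicate, mul_comm]
  · intro k
    cases k <;> simp [Regs.get]
  · have h3 : B ^ 3 ≤ B ^ 9 := Nat.pow_le_pow_right (by omega) (by omega)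
    have h9 := pow_step hB 9 10
    have h10 := pow_step hB 10 11
    have h11 := pow_step hB 11 12
    simp
    omega

end CounterProg

/-! ### Writing the entries and the modulus, in reverse. -/

namespace CounterProg

variable {S : Type}

open List (replicate)

/-- The coefficient vector of `z ^ e`, of length `D`, followed by a separator. -/
def entryWord (o l w : S) (D e : ℕ) : List S :=
  replicate e o ++ l :: (replicate (D - 1 - e) o ++ [w])

/-- Output the coefficient vector of `z ^ e`. -/
def emitEntry (o l w : S) : CounterProg Reg S :=
  seq (emit w) <| seq (move .deg [.x, .y]) <| seq (move .x [.deg]) <|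
  seq (loop .e <| seq (dec .e) <| seq (incs [.x]) (dec .y)) <| seq (dec .y) <|
  seq (moveEmit .y [] o) <| seq (emit l) <| moveEmit .x [.e] o

/-- The output stack has the latest symbol on top, so the word is emitted from its end: separator,
deg - 1 - e zeros, the one, e zeros. The first loop splits a copy of `deg` into e (in `x`) and deg -
e (in `y`); the last loop restores `e`. -/
theorem runs_emitEntry {a l w : S} {B : ℕ} (hB : 20 ≤ B) {v : Regs} {o : List S} (hx : v.x = 0)
    (hy : v.y = 0) (he : v.e < v.deg) (hdeg : v.deg ≤ B) :
    Runs (emitEntry a l w) v.get o v.get (entryWord a l w v.deg v.e ++ o) (B ^ 5) := by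
  obtain ⟨n, row, col, z, u, t, q, s, p, e, deg, R, x, y⟩ := v
  simp only at *
  subst hx hy
  refine .mono (.seq (.emit w _ _) <|
    .seq (runs_move (v' := Regs.mk n row col z u t q s p e 0 R deg deg) (B := B) ?_ (by simp)
      (by simp; omega) hB hdeg) <|
    .seq (runs_move (v' := Regs.mk n row col z u t q s p e deg R 0 deg) (B := B) ?_ (by simp)
      (by simp; omega) hB hdeg) <|
    .seq (runs_loop (v' := Regs.mk n row col z u t q s p 0 deg R e (deg - e))
      (fun i => Regs.mk n row col z u t q s p (e - i) deg R i (deg - i)) (fun _ => w :: o) (B := B)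
      (N := e) (c := 1) ?_ rfl ?_ rfl hB (by omega) ?_ ?_) <|
    .seq (runs_dec (v' := Regs.mk n row col z u t q s p 0 deg R e (deg - 1 - e)) ?_) <|
    .seq (runs_moveEmit (v' := Regs.mk n row col z u t q s p 0 deg R e 0) (B := B)
      ?_ rfl (by simp) (by simp) hB ?_) <|
    .seq (.emit l _ _) <|
    (runs_moveEmit (B := B) ?_ ?_ (by simp) (by simp; omega) hB ?_)) ?_
  · intro k
    cases k <;> simp [Regs.get]
  · intro k
    cases k <;> simp [Regs.get]
  · simp
  · simp
  · intro i _
    rfl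
  · intro i hi
    refine .mono (.seq (runs_dec (v' := Regs.mk n row col z u t q s p (e - (i + 1)) deg R i
      (deg - i)) ?_) <|
      .seq (runs_incs (v' := Regs.mk n row col z u t q s p (e - (i + 1)) deg R (i + 1)
      (deg - i)) ?_) (runs_dec ?_)) ?_
    · intro k
      cases k <;> simp [Regs.get]
      omega
    · intro k
      cases k <;> simp [Regs.get]
    · intro k
      cases k <;> simp [Regs.get]
      omega
    · simp
      omega
  · intro k
    cases k <;> simp [Regs.get]
    omega
  · intro k
    cases k <;> simp [Regs.get]
  · simp only [Regs.get]
    omega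
  · intro k
    cases k <;> simp [Regs.get]
  · simp [entryWord, Regs.get]
  · simp only [Regs.get]
    omega
  · have h3 := pow_step hB 3 4
    have h4 := pow_step hB 4 5
    have e3 : B ^ (1 + 2) = B ^ 3 := rfl
    omega

/-- The step between the exponents of the `g`-th group; there are `T` groups of size `Q`. -/
def place (T Q g : ℕ) : ℕ := if g < T then Q ^ g else 0

/-- The exponent of the `k`-th entry. -/
def expo (T Q k : ℕ) : ℕ := k % Q * place T Q (k / Q)

theorem place_mul_le {T Q : ℕ} (hQ : 1 ≤ Q) (g : ℕ) : Q * place T Q g ≤ Q ^ T := by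
  unfold place
  split_ifs with h
  · rw [← pow_succ']
    exact Nat.pow_le_pow_right hQ h
  · simp

/-- This bounds the exponent register also at the end of a group, where it overshoots before being
reset. -/
theorem expo_add_place_le {T Q : ℕ} (hQ : 1 ≤ Q) (k : ℕ) :
    expo T Q k + place T Q (k / Q) ≤ Q ^ T := by
  have h : k % Q + 1 ≤ Q := Nat.mod_lt _ hQ
  calc expo T Q k + place T Q (k / Q) = (k % Q + 1) * place T Q (k / Q) := by
        rw [expo, add_mul, one_mul]
    _ ≤ Q * place T Q (k / Q) := by gcongr
    _ ≤ Q ^ T := place_mul_le hQ _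

theorem expo_lt {T Q : ℕ} (hQ : 1 ≤ Q) (k : ℕ) : expo T Q k < Q ^ T := by
  have h := expo_add_place_le (T := T) hQ k
  by_cases hp : place T Q (k / Q) = 0
  · rw [expo, hp, mul_zero]
    exact pow_pos hQ _
  · omega

/-- Pass from the exponent of one entry to that of the next one. -/
def advance : CounterProg Reg S :=
  seq (move .p [.x, .e]) <| seq (move .x [.p]) <| seq (dec .q) <| seq (incs [.s]) <|
  ite .q skip <| seq (move .s [.q]) <| seq (move .p []) <| seq (move .e [.p]) <| seq (dec .t) <|
  ite .t skip (move .p [])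

/-- The counters before the `k`-th entry is written. -/
def entryRegs (T Q : ℕ) (v : Regs) (k : ℕ) : Regs :=
  { v with t := T - k / Q, q := Q - k % Q, s := k % Q, p := place T Q (k / Q), e := expo T Q k }

/-- After Q additions of the step Q^g, the exponent register holds Q^(g+1), which is the step of the
next group; it is moved into `p`, so no multiplication is needed. -/
theorem runs_advance {T Q B k : ℕ} (hB : 20 ≤ B) {v : Regs} {o : List S} (hQ : 1 ≤ Q)
    (hQB : Q ≤ B) (hP : Q ^ T ≤ B) (hx : v.x = 0) :
    Runs advance (entryRegs T Q v k).get o (entryRegs T Q v (k + 1)).get o (B ^ 4) := by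
  obtain ⟨n, row, col, z, u, t, q, s, p, e, deg, R, x, y⟩ := v
  have hle := expo_add_place_le (T := T) hQ k
  have h3 := pow_step hB 3 4
  have hlt : k % Q < Q := Nat.mod_lt _ hQ
  simp only [entryRegs] at *
  subst hx
  refine .mono (.seq (runs_move (v' := Regs.mk n row col z u (T - k / Q) (Q - k % Q) (k % Q) 0
      (expo T Q k + place T Q (k / Q)) deg R (place T Q (k / Q)) y) (B := B) ?_ (by simp)
      (by simp; omega) hB ?_) <|
    .seq (runs_move (v' := Regs.mk n row col z u (T - k / Q) (Q - k % Q) (k % Q)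
      (place T Q (k / Q)) (expo T Q k + place T Q (k / Q)) deg R 0 y) (B := B) ?_ (by simp)
      (by simp; omega) hB ?_) <|
    .seq (runs_dec (v' := Regs.mk n row col z u (T - k / Q) (Q - k % Q - 1) (k % Q)
      (place T Q (k / Q)) (expo T Q k + place T Q (k / Q)) deg R 0 y) ?_) <|
    .seq (runs_incs (v' := Regs.mk n row col z u (T - k / Q) (Q - k % Q - 1) (k % Q + 1)
      (place T Q (k / Q)) (expo T Q k + place T Q (k / Q)) deg R 0 y) ?_) <|
    (?_ : Runs _ _ _ _ _ (10 * B ^ 3))) ?_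
  · intro k
    cases k <;> simp [Regs.get]
  · simp only [Regs.get]
    omega
  · intro k
    cases k <;> simp [Regs.get]
  · simp only [Regs.get]
    omega
  · intro k
    cases k <;> simp [Regs.get]
  · intro k
    cases k <;> simp [Regs.get]
  · by_cases hk : k % Q + 1 = Q
    · have hd : (k + 1) / Q = k / Q + 1 := by
        rw [Nat.succ_div_of_dvd]
        rw [Nat.dvd_iff_mod_eq_zero, Nat.add_mod_eq_ite]
        rcases Nat.eq_or_lt_of_le hQ with h | h
        · simp [← h, Nat.mod_one]
        · simp [Nat.mod_eq_of_lt h, hk]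
      have hm : (k + 1) % Q = 0 := by
        rw [Nat.add_mod_eq_ite]
        rcases Nat.eq_or_lt_of_le hQ with h | h
        · simp [← h, Nat.mod_one]
        · simp [Nat.mod_eq_of_lt h, hk]
      have he : expo T Q (k + 1) = 0 := by rw [expo, hm, zero_mul]
      have hs : expo T Q k + place T Q (k / Q) = Q * place T Q (k / Q) := by
        calc expo T Q k + place T Q (k / Q) = (k % Q + 1) * place T Q (k / Q) := by
              rw [expo, add_mul, one_mul]
          _ = _ := by rw [hk]
      rw [hd, hm, he, hs]
      rw [hs] at hle
      refine .mono (.ite_zero (by simp only [Regs.get]; omega) <|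
        .seq (runs_move (v' := Regs.mk n row col z u (T - k / Q) Q 0
          (place T Q (k / Q)) (Q * place T Q (k / Q)) deg R 0 y) (B := B) ?_ (by simp)
          (by simp; omega) hB ?_) <|
        .seq (runs_move (v' := Regs.mk n row col z u (T - k / Q) Q 0
          0 (Q * place T Q (k / Q)) deg R 0 y) (B := B) ?_ (by simp)
          (by simp) hB ?_) <|
        .seq (runs_move (v' := Regs.mk n row col z u (T - k / Q) Q 0
          (Q * place T Q (k / Q)) 0 deg R 0 y) (B := B) ?_ (by simp)
          (by simp; omega) hB ?_) <|
        .seq (runs_dec (v' := Regs.mk n row col z u (T - (k / Q + 1)) Q 0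
          (Q * place T Q (k / Q)) 0 deg R 0 y) ?_) <|
        (?_ : Runs _ _ _ _ _ (1 + B ^ 3))) ?_
      · intro k'
        cases k' <;> simp [Regs.get]
        omega
      · simp only [Regs.get]
        omega
      · intro k'
        cases k' <;> simp [Regs.get]
      · simp only [Regs.get]
        omega
      · intro k'
        cases k' <;> simp [Regs.get]
      · simp only [Regs.get]
        omega
      · intro k'
        cases k' <;> simp [Regs.get]
        omega
      -- Past the last group the step becomes 0, so all surplus entries are z^0.
      · by_cases ht : k / Q + 1 < T
        · refine .ite_succ (by simp only [Regs.get]; omega) ((Runs.skip _ _).of_eq (fun _ => rfl)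
            (fun k' => ?_) rfl rfl h3.1)
          have : place T Q (k / Q + 1) = Q * place T Q (k / Q) := by
            rw [place, place, if_pos ht, if_pos (by omega), pow_succ']
          cases k' <;> simp [Regs.get, this]
        · refine .ite_zero (by simp only [Regs.get]; omega) (runs_move (B := B) ?_ (by simp)
            (by simp) hB ?_)
          · have : place T Q (k / Q + 1) = 0 := by rw [place, if_neg ht]
            intro k'
            cases k' <;> simp [Regs.get, this]
          · simp only [Regs.get]
            omega
      · omega
    · have hnd : ¬ Q ∣ k + 1 := by
        intro h
        have h' : (k % Q + 1) % Q = 0 := by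
          rw [Nat.mod_add_mod]
          exact Nat.mod_eq_zero_of_dvd h
        rw [Nat.mod_eq_of_lt (by omega)] at h'
        omega
      have hd : (k + 1) / Q = k / Q := Nat.succ_div_of_not_dvd hnd
      have hm : (k + 1) % Q = k % Q + 1 := by
        rw [← Nat.mod_add_mod, Nat.mod_eq_of_lt (by omega)]
      have he : expo T Q (k + 1) = expo T Q k + place T Q (k / Q) := by
        rw [expo, expo, hm, hd, add_mul, one_mul]
      rw [hd, hm, he, Nat.sub_add_eq]
      exact (Runs.ite_succ (by simp only [Regs.get]; omega) (.skip _ _)).mono (by omega)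
  · simp
    omega

/-- Output all entries, the last one first. -/
def emitEntries (a l w : S) : CounterProg Reg S :=
  loop .row <| seq (dec .row) <|
    seq (loop .col <| seq (dec .col) <| seq (incs [.n]) <| seq (emitEntry a l w) advance) <|
    move .n [.col]

/-- The words of the first `k` exponents, the last one first. -/
def entryWords (a l w : S) (T Q D : ℕ) : ℕ → List S
  | 0 => []
  | k + 1 => entryWord a l w D (expo T Q k) ++ entryWords a l w T Q D k

/-- The register `n`, empty by now, counts the visited columns so that `col` can be restored for the
next row. -/
theorem runs_emitEntries {a l w : S} {T Q B N : ℕ} (hB : 20 ≤ B) {v : Regs} {o : List S}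
    (hQ : 1 ≤ Q) (hQB : Q ≤ B) (hP : Q ^ T ≤ v.deg) (hdeg : v.deg ≤ B) (hx : v.x = 0)
    (hy : v.y = 0) (hn : v.n = 0) (hcol : v.col = N) (hrow : v.row = N) (hN : N ≤ B)
    (ht : v.t = T) (hq : v.q = Q) (hs : v.s = 0) (hp : v.p = place T Q 0) (he : v.e = 0) :
    Runs (emitEntries a l w) v.get o ({ entryRegs T Q v (N * N) with row := 0 } : Regs).get
      (entryWords a l w T Q v.deg (N * N) ++ o) (B ^ 11) := by
  have h3 := pow_step hB 3 4
  have h4 := pow_step hB 4 5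
  have h5 := pow_step hB 5 6
  have h6 := pow_step hB 6 7
  have h7 := pow_step hB 7 8
  have h8 := pow_step hB 8 9
  refine runs_loop (fun i => { entryRegs T Q v (i * N) with row := N - i })
    (fun i => entryWords a l w T Q v.deg (i * N) ++ o) (c := 9) ?_ ?_ ?_ ?_ hB hN ?_ ?_
  · obtain ⟨n, row, col, z, u, t, q, s, p, e, deg, R, x, y⟩ := v
    simp only at *
    subst ht hq hs hp he hrow
    simp [entryRegs, expo]
  · simp [entryWords]
  · simp
  · rfl
  · intro i _
    rfl
  · intro i hi
    refine .mono (.seq (runs_dec (v' := { entryRegs T Q v (i * N) with row := N - (i + 1) }) ?_) <|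
      .seq (runs_loop (v' := { entryRegs T Q v ((i + 1) * N) with
          row := N - (i + 1), col := 0, n := N })
        (fun j => { entryRegs T Q v (i * N + j) with row := N - (i + 1), col := N - j, n := j })
        (fun j => entryWords a l w T Q v.deg (i * N + j) ++ o) (B := B) (c := 6) ?_ rfl ?_ ?_ hB hN
        ?_ ?_) <|
      (runs_move (B := B) ?_ (by simp) (by simp; omega) hB ?_)) ?_
    · intro k
      cases k <;> simp [Regs.get, entryRegs]
      omega
    · simp [entryRegs, hn, hcol]
    · simp [add_mul]
    · simp [add_mul]
    · intro j _
      rfl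
    · intro j hj
      refine .mono (.seq (runs_dec (v' := { entryRegs T Q v (i * N + j) with
          row := N - (i + 1), col := N - (j + 1), n := j }) ?_) <|
        .seq (runs_incs (v' := { entryRegs T Q v (i * N + j) with
          row := N - (i + 1), col := N - (j + 1), n := j + 1 }) ?_) <|
        .seq (runs_emitEntry (B := B) hB hx hy
          ((expo_lt hQ _).trans_le hP) hdeg) <|
        (runs_advance (T := T) (Q := Q) (k := i * N + j)
          (v := { v with row := N - (i + 1), col := N - (j + 1), n := j + 1 })
          hB hQ hQB (hP.trans hdeg) hx).of_eq (fun _ => rfl) (fun _ => rfl) rfl ?_ le_rfl) ?_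
      · intro k
        cases k <;> simp [Regs.get, entryRegs]
        omega
      · intro k
        cases k <;> simp [Regs.get, entryRegs]
      · rw [← List.append_assoc]
        rfl
      · simp
        omega
    · intro k
      cases k <;> simp [Regs.get, entryRegs, hcol, hn]
    · simpa [Regs.get] using hN
    · have e8 : B ^ (6 + 2) = B ^ 8 := rfl
      omega

/-- Output the lower coefficients of a polynomial, each preceded by `R` zeros. -/
def emitCoeffs (a : S) (cs : List S) : CounterProg Reg S :=
  cs.foldr (fun c p => seq (move .R [.x]) <| seq (moveEmit .x [.R] a) <| seq (emit c) p) skip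

theorem runs_emitCoeffs {a : S} {B : ℕ} (hB : 20 ≤ B) (cs : List S) {v : Regs} {o : List S}
    (hR : v.R ≤ B) (hx : v.x = 0) :
    Runs (emitCoeffs a cs) v.get o v.get
      (cs.foldl (fun o c => c :: (replicate v.R a ++ o)) o) (cs.length * B ^ 4 + 1) := by
  have h3 := pow_step hB 3 4
  induction cs generalizing o with
  | nil => exact (Runs.skip _ _).mono (by simp)
  | cons c cs ih =>
    refine .mono (.seq (runs_move (v' := { v with R := 0, x := v.R }) (B := B) ?_ (by simp)
      (by simp; omega) hB hR) <| .seq (runs_moveEmit (v' := v) (B := B) ?_ rfl (by simp)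
      (by simp; omega) hB hR) <| .seq (.emit c _ _) ih) ?_
    · intro k
      cases k <;> simp [Regs.get, hx]
    · intro k
      cases k <;> simp [Regs.get, hx]
    · simp only [List.length_cons, Nat.succ_mul]
      omega

/-- The program that writes the description of the matrix. -/
def matrixProg (b τ κ : ℕ) (a l w : S) (cs : List S) : CounterProg Reg S :=
  seq (params b τ κ) <| seq (powers cs.length) <| seq (emitEntries a l w) <| seq (emit w) <|
  seq (emit l) <| seq (dec .R) <| seq (emitCoeffs a cs) <|
  clear [.col, .z, .u, .t, .q, .s, .p, .e, .deg, .R]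

/-- The description of the matrix of size `N`: the coefficients `cs` of a monic polynomial,
highest first, spread out by a factor `Q ^ T`, and the words of all entries. -/
def description (T Q N : ℕ) (a l w : S) (cs : List S) : List S :=
  cs.foldl (fun o c => c :: (replicate (Q ^ T - 1) a ++ o))
    (l :: w :: entryWords a l w T Q (cs.length * Q ^ T) (N * N))

/-- `R` is decremented because consecutive coefficients of f are separated by Q^T - 1 zeros in
f(X^(Q^T)). The final clearing is needed since a halted machine must have only its output stack
nonempty. The dominant cost B^12 comes from `powers`. -/
theorem runs_matrixProg {b τ κ B N : ℕ} (a l w : S) (cs : List S) (hB : 20 ≤ B) (hb2 : 2 ≤ b)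
    (hb : b + b * (b - 1) ≤ B) (hτ : τ ≤ B) (hκ : κ ≤ B) (hτ1 : 1 ≤ τ) (hκ1 : 1 ≤ κ) (hN : N ≤ B)
    (hu : b ^ (Nat.log b N + 1) ≤ B) (ht : τ ^ Nat.log b N ≤ B) (hq : κ ^ Nat.log b N ≤ B)
    (hcs : cs.length + 1 ≤ B) (hcs1 : 1 ≤ cs.length)
    (hD : cs.length * (κ ^ Nat.log b N) ^ (τ ^ Nat.log b N) ≤ B) :
    Runs (matrixProg b τ κ a l w cs) (Function.update (fun _ => 0) .n N) [] (fun _ => 0)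
      (description (τ ^ Nat.log b N) (κ ^ Nat.log b N) N a l w cs) (B ^ 13) := by
  set J := Nat.log b N with hJ
  set T := τ ^ J with hT
  set Q := κ ^ J with hQ
  have hT1 : 1 ≤ T := Nat.one_le_pow _ _ hτ1
  have hQ1 : 1 ≤ Q := Nat.one_le_pow _ _ hκ1
  have hPD : Q ^ T ≤ cs.length * Q ^ T := Nat.le_mul_of_pos_left _ hcs1
  have hu' : b ^ J ≤ B := (Nat.pow_le_pow_right (by omega) (by omega)).trans hu
  have hRp : 1 ≤ Q ^ T := Nat.one_le_pow _ _ hQ1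
  refine Runs.of_eq (c := B ^ 8 + (B ^ 12 + (B ^ 11 + (1 + (1 + (1 +
    ((cs.length * B ^ 4 + 1) + (10 * (B * 3 + 1) + 1))))))))
    (s := (Regs.mk N 0 0 0 0 0 0 0 0 0 0 0 0 0).get)
    (.seq (runs_params hB hb2 hb hτ hκ hτ1 hκ1 hN hu' ht hq) <|
    .seq (runs_powers hB hcs rfl rfl rfl rfl rfl rfl ht hQ1 hq (hPD.trans hD)) <|
    .seq (runs_emitEntries (B := B) (T := T) (Q := Q) (N := N) hB hQ1 hq hPD hD rfl rfl rfl rfl rfl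
      hN rfl rfl rfl (by simp [place, hT1, Nat.lt_of_succ_le]) rfl) <|
    .seq (.emit w _ _) <| .seq (.emit l _ _) <|
    .seq (runs_dec (v' := ({ entryRegs T Q (Regs.mk 0 0 N (b ^ (J + 1) - N) (b ^ J) T Q 0 0 0
      (cs.length * Q ^ T) (Q ^ T - 1) 0 0) (N * N) with row := 0 } : Regs)) ?_) <|
    .seq (runs_emitCoeffs hB cs ?_ rfl) (Runs.clear _ _ _ B ?_))
    ?_ ?_ rfl ?_ ?_
  · intro k
    cases k <;> simp [Regs.get, entryRegs, hT, hQ, hJ]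
  · simp only [entryRegs]
    omega
  · intro k
    have h3 : T - N * N / Q ≤ B := (Nat.sub_le _ _).trans ht
    have h1 := expo_add_place_le (T := T) hQ1 (N * N)
    have h2 : N * N % Q < Q := Nat.mod_lt _ hQ1
    cases k <;> simp only [Regs.get, entryRegs] <;> first | assumption | omega
  · intro k
    cases k <;> simp [Regs.get, Function.update]
  · intro k
    cases k <;> simp [Regs.get, entryRegs]
  · simp [description, entryRegs, hT, hQ, hJ]
  · have h1 := pow_step hB 1 2
    have h12 := pow_step hB 12 13
    have e4 : cs.length * B ^ 4 ≤ B ^ 5 := by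
      rw [pow_succ' B 4]
      exact Nat.mul_le_mul_right _ (by omega)
    have e5 : B ^ 5 ≤ B ^ 12 := Nat.pow_le_pow_right (by omega) (by omega)
    have e8 : B ^ 8 ≤ B ^ 12 := Nat.pow_le_pow_right (by omega) (by omega)
    have e11 : B ^ 11 ≤ B ^ 12 := Nat.pow_le_pow_right (by omega) (by omega)
    have e1 : B ≤ B ^ 5 := Nat.le_self_pow (by omega) B
    have e2 : 3 * B + 5 ≤ B ^ 5 := by
      have : B ^ 2 ≤ B ^ 5 := Nat.pow_le_pow_right (by omega) (by omega)
      rw [pow_one] at h1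
      omega
    omega

end CounterProg

/-! ### Irreducible polynomials of the form f(X^(r^k)). -/

open Polynomial in
/-- Over a finite field there are an odd prime `r` and a monic polynomial `f` such that all
polynomials `f (X ^ (r ^ k))` are irreducible. -/
theorem exists_irreducible_expand_prime_pow (F : Type) [Field F] [Finite F] :
    ∃ (r : ℕ) (f : F[X]), r.Prime ∧ 3 ≤ r ∧ f.Monic ∧ ∀ k, Irreducible (expand F (r ^ k) f) := by
  obtain ⟨p, hp⟩ := CharP.exists F
  have hp0 : p.Prime := (CharP.char_is_prime_or_zero F p).resolve_right (CharP.char_ne_zero_of_finite F p)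
  -- r > p makes r nonzero in F, so primitive r-th roots of unity exist; r ≥ 3 excludes the
  -- exceptional prime 2 in the criterion for X^(r^k) - x.
  obtain ⟨r, hpr, hr⟩ := Nat.exists_infinite_primes (p + 3)
  have hrF : (r : F) ≠ 0 := by
    rw [Ne, CharP.cast_eq_zero_iff F p, Nat.prime_dvd_prime_iff_eq hp0 hr]
    omega
  have : NeZero (r : F) := ⟨hrF⟩
  have : NeZero r := ⟨hr.ne_zero⟩
  let E := CyclotomicField r F
  have : FiniteDimensional F E := IsCyclotomicExtension.finite_of_singleton r F E
  have : Finite E := Module.finite_of_finite F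
  obtain ⟨α, hα⟩ := IsCyclic.exists_generator (α := Eˣ)
  have hαord : orderOf α = Nat.card E - 1 := by
    rw [orderOf_eq_card_of_forall_mem_zpowers hα, Nat.card_units]
  have hrdvd : r ∣ Nat.card E - 1 := by
    have hζ := IsCyclotomicExtension.zeta_spec r F E
    have h2 := hζ.isUnit_unit hr.ne_zero
    have h3 := orderOf_dvd_natCard (hζ.isUnit hr.ne_zero).unit
    rwa [← h2.eq_orderOf, Nat.card_units] at h3
  have hcard : 0 < Nat.card E - 1 := by
    have := Finite.one_lt_card (α := E)
    omega
  have htop : IntermediateField.adjoin F {(α : E)} = ⊤ := by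
    rw [eq_top_iff]
    intro y _
    by_cases hy : y = 0
    · rw [hy]
      exact zero_mem _
    · obtain ⟨m, hm⟩ := Subgroup.mem_zpowers_iff.mp (hα (Units.mk0 y hy))
      have hy' : y = (α : E) ^ m := by
        rw [← Units.val_zpow_eq_zpow_val, hm, Units.val_mk0]
      rw [hy']
      exact zpow_mem (IntermediateField.mem_adjoin_simple_self F (α : E)) m
  have hint : IsIntegral F (α : E) := Algebra.IsIntegral.isIntegral _
  have hdeg : Nat.card F ^ (minpoly F (α : E)).natDegree = Nat.card E := by
    rw [← IntermediateField.adjoin.finrank hint, htop, IntermediateField.finrank_top',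
      Module.natCard_eq_pow_finrank (K := F) (V := E)]
  refine ⟨r, minpoly F (α : E), hr, by omega, minpoly.monic hint, fun k => ?_⟩
  rw [expand_eq_comp_X_pow]
  -- For f the minimal polynomial of a generator α of the group of units of E, it remains to see
  -- that X^(r^k) - x is irreducible over F(x) for each root x of f, that is, that x is not an r-th
  -- power in F(x).
  refine irreducible_comp (minpoly.monic hint) (monic_X_pow _) (minpoly.irreducible hint) ?_
  intro K _ _ x hx
  rw [Polynomial.map_pow, Polynomial.map_X]
  refine X_pow_sub_C_irreducible_of_prime_pow hr (by omega) k fun y hy => ?_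
  have hxint : IsIntegral F x := by
    by_contra h
    rw [minpoly.eq_zero h] at hx
    exact minpoly.ne_zero hint hx.symm
  have : FiniteDimensional F (IntermediateField.adjoin F {x}) :=
    IntermediateField.adjoin.finiteDimensional hxint
  have : Finite (IntermediateField.adjoin F {x}) := Module.finite_of_finite F
  -- F(x) has as many elements as E. With |E| - 1 = r a, an equation x = y^r would give x^a =
  -- y^(|E|-1) = 1.
  have hcardL : Nat.card (IntermediateField.adjoin F {x}) = Nat.card E := by
    rw [Module.natCard_eq_pow_finrank (K := F), IntermediateField.adjoin.finrank hxint, hx, hdeg]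
  obtain ⟨a, ha⟩ := hrdvd
  have hy1 : (IntermediateField.AdjoinSimple.gen F x) ^ a = 1 := by
    let _ := Fintype.ofFinite (IntermediateField.adjoin F {x})
    rw [← hy, ← pow_mul, ← ha, ← hcardL, Nat.card_eq_fintype_card]
    refine FiniteField.pow_card_sub_one_eq_one y fun h0 => ?_
    rw [h0, zero_pow hr.ne_zero] at hy
    have hx0 : x = 0 := by
      rw [← IntermediateField.AdjoinSimple.coe_gen F x, ← hy]
      rfl
    rw [hx0, minpoly.zero] at hx
    have := minpoly.aeval F (α : E)
    rw [← hx, aeval_X] at this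
    exact α.ne_zero this
  have hx1 : x ^ a = 1 := by
    rw [← IntermediateField.AdjoinSimple.coe_gen F x, ← IntermediateField.coe_pow, hy1]
    rfl
  -- The relation passes from x to its conjugate α, although α has order r a > a.
  have hdvd : minpoly F (α : E) ∣ X ^ a - 1 := by
    rw [← hx]
    exact minpoly.dvd F x (by simp [hx1])
  have hα1 : α ^ a = 1 := by
    have h0 := aeval_eq_zero_of_dvd_aeval_eq_zero hdvd (minpoly.aeval F (α : E))
    ext
    simpa [sub_eq_zero] using h0
  have hle := Nat.le_of_dvd (by
    rcases Nat.eq_zero_or_pos a with h | h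
    · simp [h] at ha
      omega
    · exact h) (orderOf_dvd_of_pow_eq_one hα1)
  rw [hαord, ha] at hle
  nlinarith

/-! ### The dimension argument for circuits of bounded depth. -/

namespace LinearCircuit

variable {K : Type} [Field K] {n : ℕ}

theorem IsPath.snoc {C : LinearCircuit K n} {u v w : C.Gate} {l : ℕ} (h : C.IsPath u v l)
    (e : (v, w) ∈ C.edges) : C.IsPath u w (l + 1) := by
  induction h with
  | nil u => exact .cons e (.nil w)
  | cons e' _ ih => exact .cons e' (ih e)

/-- The span over `F` of `1` and the labels of the edges. -/
def labelSpan (F : Type) [Field F] [Algebra F K] (C : LinearCircuit K n) : Submodule F K :=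
  Submodule.span F (Set.range fun e : Option C.edges => e.elim 1 fun e => C.label e)

variable {F : Type} [Field F] [Algebra F K]

theorem one_le_labelSpan (C : LinearCircuit K n) : 1 ≤ C.labelSpan F := by
  rw [Submodule.one_le]
  exact Submodule.subset_span ⟨none, rfl⟩

theorem label_mem_labelSpan (C : LinearCircuit K n) {e : C.Gate × C.Gate} (he : e ∈ C.edges) :
    C.label e ∈ C.labelSpan F :=
  Submodule.subset_span ⟨some ⟨e, he⟩, rfl⟩

theorem wellFounded_edges (C : LinearCircuit K n) :
    WellFounded (Relation.TransGen fun a b => (a, b) ∈ C.edges) := by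
  have := C.finiteGate
  have : Std.Irrefl (Relation.TransGen fun a b => (a, b) ∈ C.edges) := ⟨C.acyclic⟩
  exact Finite.wellFounded_of_trans_of_irrefl _

/-- On a unit vector, a gate at depth at most `k` has its value in the `k`-th power of the span of
the labels. -/
theorem IsEvaluation.mem_labelSpan_pow {C : LinearCircuit K n} {j : Fin n} {v : C.Gate → K}
    (hv : C.IsEvaluation (Pi.single j 1) v) (g : C.Gate) :
    (∀ k, (∀ l, C.IsPath (C.input j) g l → l ≤ k) → v g ∈ C.labelSpan F ^ k) ∧
      ((∀ l, ¬ C.IsPath (C.input j) g l) → v g = 0) := by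
  classical
  induction g using C.wellFounded_edges.induction with
  | _ g ih =>
  by_cases hg : g ∈ Set.range C.input
  · obtain ⟨i, rfl⟩ := hg
    rw [hv.1 i]
    by_cases hij : i = j
    · subst hij
      refine ⟨fun k _ => ?_, fun h => (h 0 (.nil _)).elim⟩
      rw [Pi.single_eq_same, ← Submodule.one_le]
      exact one_le_pow_of_one_le' C.one_le_labelSpan k
    · rw [Pi.single_eq_of_ne hij]
      exact ⟨fun k _ => zero_mem _, fun _ => rfl⟩
  · rw [hv.2 g hg]
    constructor
    · intro k hk
      refine sum_mem fun e he => ?_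
      obtain ⟨heE, rfl⟩ := Finset.mem_filter.mp he
      have ihe := ih e.1 (.single heE)
      -- Depth controls only paths starting at the input. A reachable predecessor forces k ≥ 1 and
      -- has depth at most k - 1; an unreachable one contributes 0, which is why both claims are
      -- proved together.
      by_cases hp : ∃ l, C.IsPath (C.input j) e.1 l
      · obtain ⟨l, hl⟩ := hp
        obtain ⟨k, rfl⟩ : ∃ k', k = k' + 1 :=
          Nat.exists_eq_succ_of_ne_zero (by have := hk _ (hl.snoc heE); omega)
        rw [pow_succ']
        refine Submodule.mul_mem_mul (C.label_mem_labelSpan heE) (ihe.1 k fun l' hl' => ?_)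
        have := hk _ (hl'.snoc heE)
        omega
      · rw [ihe.2 (not_exists.mp hp), mul_zero]
        exact zero_mem _
    · intro h
      refine Finset.sum_eq_zero fun e he => ?_
      obtain ⟨heE, rfl⟩ := Finset.mem_filter.mp he
      rw [(ih e.1 (.single heE)).2 fun l hl => h _ (hl.snoc heE), mul_zero]

/-- The j-th column of M is the output on the j-th unit vector. -/
theorem Computes.entry_mem {C : LinearCircuit K n} {M : Matrix (Fin n) (Fin n) K} {d : ℕ}
    (h : C.Computes M) (hd : C.DepthAtMost d) (i j : Fin n) : M i j ∈ C.labelSpan F ^ d := by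
  obtain ⟨v, hv, hM⟩ := h (Pi.single j 1)
  have h1 := hM i
  rw [Matrix.mulVec_single_one] at h1
  have h2 := (hv.mem_labelSpan_pow (F := F) (C.output i)).1 d fun l => hd j i l
  rw [h1] at h2
  exact h2

/-- The powers of the span of the labels are spanned by the monomials in the labels. -/
theorem finrank_labelSpan_pow_le (C : LinearCircuit K n) (k : ℕ) :
    FiniteDimensional F ↥(C.labelSpan F ^ k) ∧
      Module.finrank F ↥(C.labelSpan F ^ k) ≤ (C.size + k).choose k := by
  classical
  let f : Option C.edges → K := fun e => e.elim 1 fun e => C.label e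
  -- By commutativity unordered k-tuples suffice: s + 1 generators have binom(s + k, k) monomials of
  -- degree k.
  let b : Sym (Option C.edges) k → K := fun m => (Multiset.map f m).prod
  have hle : C.labelSpan F ^ k ≤ Submodule.span F (Set.range b) := by
    rw [labelSpan, Submodule.span_pow]
    apply Submodule.span_mono
    intro a ha
    obtain ⟨h, rfl⟩ := Set.mem_pow.mp ha
    choose e he using fun i => (h i).2
    refine ⟨⟨(List.ofFn e : Multiset _), by simp⟩, ?_⟩
    change (Multiset.map f (List.ofFn e : Multiset _)).prod = _
    rw [Multiset.map_coe, Multiset.prod_coe, List.map_ofFn]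
    congr 2
    funext i
    exact he i
  have hfin : FiniteDimensional F ↥(Submodule.span F (Set.range b)) :=
    FiniteDimensional.span_of_finite F (Set.finite_range b)
  refine ⟨Submodule.finiteDimensional_of_le hle, (Submodule.finrank_mono hle).trans ?_⟩
  refine (finrank_range_le_card b).trans ?_
  rw [Sym.card_sym_eq_multichoose, Nat.multichoose_eq]
  simp [size]

/-- A matrix that contains the powers of a primitive element with the exponents `c * Q ^ g`,
for `c < Q` and `g < T`, has no small circuits of small depth. -/
theorem Computes.pow_le_choose {C : LinearCircuit K n} {M : Matrix (Fin n) (Fin n) K} {d T Q : ℕ}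
    (h : C.Computes M) (hd : C.DepthAtMost d) (β : K) (hβ : Q ^ T ≤ (minpoly F β).natDegree)
    (hM : ∀ c < Q, ∀ g < T, ∃ i j, M i j = β ^ (c * Q ^ g)) :
    Q ^ T ≤ (C.size + d * T).choose (d * T) := by
  have key : ∀ t ≤ T, ∀ x < Q ^ t, β ^ x ∈ C.labelSpan F ^ (d * t) := by
    intro t
    induction t with
    | zero =>
      intro _ x hx
      obtain rfl : x = 0 := by simpa using hx
      simp only [pow_zero, mul_zero]
      exact Submodule.one_le.mp le_rfl
    | succ t ih =>
      intro ht x hx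
      have hQ : 0 < Q ^ t := by
        rcases Nat.eq_zero_or_pos Q with rfl | hQ
        · simp at hx
        · exact pow_pos hQ t
      -- Split off the leading base-Q digit of x.
      obtain ⟨i, j, hij⟩ := hM (x / Q ^ t)
        (by rw [Nat.div_lt_iff_lt_mul hQ, ← pow_succ']; exact hx) t ht
      have hx' : β ^ x = M i j * β ^ (x % Q ^ t) := by
        rw [hij, ← pow_add, Nat.div_add_mod']
      rw [hx', mul_add, mul_one, add_comm, pow_add]
      exact Submodule.mul_mem_mul (h.entry_mem hd i j) (ih (by omega) _ (Nat.mod_lt _ hQ))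
  obtain ⟨hfin, hle⟩ := C.finrank_labelSpan_pow_le (F := F) (d * T)
  refine le_trans ?_ hle
  let w : Fin (Q ^ T) → ↥(C.labelSpan F ^ (d * T)) := fun x => ⟨β ^ (x : ℕ), key T le_rfl x x.2⟩
  have hw : LinearIndependent F w := by
    apply LinearIndependent.of_comp (Submodule.subtype _)
    exact (linearIndependent_pow (K := F) β).comp (Fin.castLE hβ) (Fin.castLE_injective hβ)
  simpa using hw.fintype_card_le_finrank

end LinearCircuit

/-! ### The matrix of powers and its encoding as a word. -/

namespace ExtensionMatrix

open CounterProg Polynomial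

theorem range_mul_flatMap {α : Type} (a b : ℕ) (f : ℕ → List α) :
    (List.range (a * b)).flatMap f =
      (List.range a).flatMap fun i => (List.range b).flatMap fun j => f (i * b + j) := by
  induction a with
  | zero => simp
  | succ a ih =>
    rw [add_mul, one_mul, List.range_add, List.flatMap_append, ih, List.range_succ,
      List.flatMap_append, List.flatMap_map]
    simp

theorem range_mul_map {α : Type} (a b : ℕ) (f : ℕ → α) :
    (List.range (a * b)).map f =
      (List.range a).flatMap fun i => (List.range b).map fun j => f (i * b + j) := by
  simp only [List.map_eq_flatMap, range_mul_flatMap]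

theorem entryWords_eq_flatMap {S : Type} (a l w : S) (T Q D k : ℕ) :
    entryWords a l w T Q D k =
      (List.range k).flatMap fun x => entryWord a l w D (expo T Q (k - 1 - x)) := by
  induction k with
  | zero => rfl
  | succ k ih =>
    rw [entryWords, ih, List.range_succ_eq_map, List.flatMap_cons, List.flatMap_map]
    congr 1
    refine List.flatMap_congr fun x _ => ?_
    congr 2
    simp only [Nat.succ_eq_add_one]
    omega

variable {F : Type} [Field F]

theorem coeffWord_eq_of_forall {k : ℕ} {p : F[X]} (h : ∀ i < k, p.coeff i = 0) :
    coeffWord k p = List.replicate k (some 0) := by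
  rw [coeffWord, List.eq_replicate_iff]
  refine ⟨by simp, fun b hb => ?_⟩
  obtain ⟨i, hi, rfl⟩ := List.mem_map.mp hb
  rw [h i (List.mem_range.mp hi)]

theorem coeffWord_X_pow {D e : ℕ} (he : e < D) :
    coeffWord D (X ^ e : F[X]) ++ [none] = entryWord (some 0) (some 1) none D e := by
  obtain ⟨k, rfl⟩ := Nat.exists_eq_add_of_lt he
  have h1 : coeffWord e (X ^ e : F[X]) = List.replicate e (some 0) :=
    coeffWord_eq_of_forall fun i hi => by rw [coeff_X_pow, if_neg (by omega)]
  rw [coeffWord, show e + k + 1 = e + (1 + k) by ring, List.range_add, List.map_append,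
    ← coeffWord, h1, add_comm 1 k, List.range_succ_eq_map, entryWord, List.append_assoc]
  congr 1
  simp only [List.map_cons, List.map_map, List.cons_append, coeff_X_pow, add_zero, if_true]
  congr 2
  rw [show e + (k + 1) - 1 - e = k by omega, List.eq_replicate_iff]
  refine ⟨by simp, fun b hb => ?_⟩
  obtain ⟨i, _, rfl⟩ := List.mem_map.mp hb
  simp

theorem modByMonicHom_root_pow {g : F[X]} (hg : g.Monic) {e : ℕ} (he : e < g.natDegree) :
    AdjoinRoot.modByMonicHom hg (AdjoinRoot.root g ^ e) = X ^ e := by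
  rw [← AdjoinRoot.mk_X, ← map_pow, AdjoinRoot.modByMonicHom_mk, modByMonic_eq_self_iff hg,
    degree_X_pow, degree_eq_natDegree hg.ne_zero]
  exact_mod_cast he

/-- The lower coefficients of `f`, highest first. -/
def lowerCoeffs (f : F[X]) : List (Option F) :=
  (List.range f.natDegree).reverse.map fun i => some (f.coeff i)

/-- Each lower coefficient of f heads a block of length R whose other symbols are zero. Prepending
these blocks highest first to the leading 1 matches the order in which the program stacks them. -/
theorem coeffWord_expand {f : F[X]} (hf : f.Monic) {R : ℕ} (hR : 0 < R) (rest : List (Option F)) :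
    coeffWord (f.natDegree * R + 1) (expand F R f) ++ rest =
      (lowerCoeffs f).foldl (fun o c => c :: (List.replicate (R - 1) (some 0) ++ o))
        (some 1 :: rest) := by
  have h1 : ∀ (l : List ℕ) (o : List (Option F)),
      l.foldr (fun i o => some (f.coeff i) :: (List.replicate (R - 1) (some 0) ++ o)) o =
        (l.flatMap fun i => some (f.coeff i) :: List.replicate (R - 1) (some 0)) ++ o := by
    intro l o
    induction l with
    | nil => rfl
    | cons i l ih => simp [ih]
  have h2 : ∀ i, ((List.range R).map fun j => some ((expand F R f).coeff (i * R + j))) =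
      some (f.coeff i) :: List.replicate (R - 1) (some 0) := by
    intro i
    obtain ⟨R, rfl⟩ := Nat.exists_eq_succ_of_ne_zero hR.ne'
    rw [List.range_succ_eq_map, List.map_cons, add_zero, coeff_expand_mul hR, List.map_map]
    congr 1
    rw [List.eq_replicate_iff]
    refine ⟨by simp, fun b hb => ?_⟩
    obtain ⟨j, hj, rfl⟩ := List.mem_map.mp hb
    have hj' := List.mem_range.mp hj
    simp only [Function.comp_apply, Option.some.injEq]
    rw [coeff_expand hR, if_neg]
    rw [Nat.dvd_add_right (Dvd.intro_left i rfl)]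
    exact fun h => absurd (Nat.le_of_dvd (Nat.succ_pos j) h) (by simp; omega)
  rw [lowerCoeffs, List.foldl_map, List.foldl_reverse, h1, coeffWord, List.range_succ,
    List.map_append, range_mul_map]
  simp only [h2]
  simp [coeff_expand_mul hR, hf.coeff_natDegree]

/-- The matrix of size `n` over `F[z] / (f (z ^ (Q ^ T)))` whose entries are powers of `z`. -/
noncomputable def powerMatrix (f : F[X]) (hf : f.Monic) (T Q : ℕ) (hQ : 1 ≤ Q)
    (hirr : Irreducible (expand F (Q ^ T) f)) (n : ℕ) : ExtensionMatrix F n where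
  modulus := expand F (Q ^ T) f
  monic := hf.expand (pow_pos hQ T)
  irreducible := hirr
  -- Positions are counted from the end because the program writes the last entry first.
  entries i j := AdjoinRoot.root _ ^ expo T Q (n * n - 1 - (i * n + j))

theorem encode_powerMatrix {f : F[X]} (hf : f.Monic) {T Q : ℕ} (hQ : 1 ≤ Q)
    (hirr : Irreducible (expand F (Q ^ T) f)) (hdeg : 1 ≤ f.natDegree) (n : ℕ) :
    (powerMatrix f hf T Q hQ hirr n).encode =
      description T Q n (some 0) (some 1) none (lowerCoeffs f) := by
  have hR : 0 < Q ^ T := pow_pos hQ T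
  have hlen : (lowerCoeffs f).length = f.natDegree := by simp [lowerCoeffs]
  have hnd : (powerMatrix f hf T Q hQ hirr n).modulus.natDegree = f.natDegree * Q ^ T :=
    natDegree_expand _ _
  have hcw : coeffWord ((powerMatrix f hf T Q hQ hirr n).modulus.natDegree + 1)
      (powerMatrix f hf T Q hQ hirr n).modulus =
      coeffWord (f.natDegree * Q ^ T + 1) (expand F (Q ^ T) f) := by
    rw [hnd]
    rfl
  rw [encode, hcw, hnd, description, hlen, coeffWord_expand hf hR,
    entryWords_eq_flatMap, range_mul_flatMap]
  congr 3
  have key : ∀ i j : Fin n, coeffWord (f.natDegree * Q ^ T) (AdjoinRoot.modByMonicHom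
      (powerMatrix f hf T Q hQ hirr n).monic ((powerMatrix f hf T Q hQ hirr n).entries i j)) ++
      [none] = entryWord (some 0) (some 1) none (f.natDegree * Q ^ T)
        (expo T Q (n * n - 1 - (i * n + j))) := by
    intro i j
    have he : expo T Q (n * n - 1 - (i * n + j)) < f.natDegree * Q ^ T :=
      (expo_lt hQ _).trans_le (Nat.le_mul_of_pos_left _ hdeg)
    rw [← coeffWord_X_pow he]
    congr 2
    exact modByMonicHom_root_pow (hf.expand hR) (he.trans_eq (natDegree_expand _ _).symm)
  simp only [key]
  rw [← List.map_coe_finRange_eq_range, List.flatMap_map]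
  refine List.flatMap_congr fun i _ => ?_
  rw [List.flatMap_map]

end ExtensionMatrix

/-! ### Choice of the parameters and the counting estimate. -/

open CounterProg ExtensionMatrix Polynomial

/-- binom(s + k, k) ≤ (s + k)^k / k! and k^k / k! ≤ e^k ≤ 3^k; the 6 is 3 times the 2 of the
hypothesis. -/
theorem choose_add_le_pow {s k M : ℕ} (h : s + k ≤ 2 * (k * M)) :
    (s + k).choose k ≤ (6 * M) ^ k := by
  have h1 : ((s + k).choose k : ℝ) ≤ ((s + k : ℕ) : ℝ) ^ k / (k.factorial : ℝ) :=
    Nat.choose_le_pow_div k (s + k)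
  have h2 : (k : ℝ) ^ k / (k.factorial : ℝ) ≤ 3 ^ k := by
    refine (Real.pow_div_factorial_le_exp (k : ℝ) (Nat.cast_nonneg k) k).trans ?_
    rw [← Real.exp_one_pow]
    exact pow_le_pow_left₀ (Real.exp_pos 1).le Real.exp_one_lt_three.le k
  have h3 : ((s + k : ℕ) : ℝ) ≤ k * (2 * M) := by
    have : ((s + k : ℕ) : ℝ) ≤ ((2 * (k * M) : ℕ) : ℝ) := by exact_mod_cast h
    refine this.trans (le_of_eq ?_)
    push_cast
    ring
  have h4 : ((s + k).choose k : ℝ) ≤ (6 * M) ^ k := by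
    calc ((s + k).choose k : ℝ) ≤ ((s + k : ℕ) : ℝ) ^ k / (k.factorial : ℝ) := h1
      _ ≤ (k * (2 * M)) ^ k / (k.factorial : ℝ) := by gcongr
      _ = (k : ℝ) ^ k / (k.factorial : ℝ) * (2 * M) ^ k := by rw [mul_pow]; ring
      _ ≤ 3 ^ k * (2 * M) ^ k := by gcongr
      _ = (6 * M) ^ k := by rw [← mul_pow]; ring
  exact_mod_cast h4

section Parameters

variable {r d n : ℕ}

/-- The number of groups of entries. -/
def numGroups (r d n : ℕ) : ℕ := (r ^ (2 * d - 1)) ^ Nat.log (r ^ (2 * d)) n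

/-- The size of each group of entries. -/
def groupSize (r d n : ℕ) : ℕ := (r ^ (2 * d + 1)) ^ Nat.log (r ^ (2 * d)) n

theorem one_le_groupSize (hr : 3 ≤ r) : 1 ≤ groupSize r d n :=
  Nat.one_le_pow _ _ (pow_pos (by omega) _)

theorem one_le_numGroups (hr : 3 ≤ r) : 1 ≤ numGroups r d n :=
  Nat.one_le_pow _ _ (pow_pos (by omega) _)

theorem numGroups_mul_groupSize_le (hd : 1 ≤ d) (hn : 1 ≤ n) :
    numGroups r d n * groupSize r d n ≤ n * n := by
  have h : numGroups r d n * groupSize r d n = (r ^ (2 * d)) ^ Nat.log (r ^ (2 * d)) n *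
      (r ^ (2 * d)) ^ Nat.log (r ^ (2 * d)) n := by
    rw [numGroups, groupSize, ← mul_pow, ← mul_pow, ← pow_add, ← pow_add]
    congr 2
    omega
  rw [h]
  have := Nat.pow_log_le_self (r ^ (2 * d)) (x := n) (by omega)
  exact Nat.mul_le_mul this this

/-- At powers of r^(2d) the fractional exponents 1 ± 1/(2d) become the integer exponents 2d ± 1 of
r, which is why n is rounded down to such a power. -/
theorem rpow_log_pow (j : ℕ) (a : ℕ) (x : ℝ)
    (h : (2 * d : ℝ) * x = a) :
    (((r ^ (2 * d)) ^ j : ℕ) : ℝ) ^ x = (r : ℝ) ^ (a * j) := by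
  have hr0 : (0 : ℝ) ≤ r := Nat.cast_nonneg r
  push_cast
  rw [← pow_mul, ← Real.rpow_natCast, ← Real.rpow_mul hr0, ← Real.rpow_natCast]
  congr 1
  push_cast
  rw [← h]
  ring

theorem numGroups_le_rpow (hd : 1 ≤ d) (hn : 1 ≤ n) :
    (numGroups r d n : ℝ) ≤ (n : ℝ) ^ (1 - 1 / (2 * (d : ℝ))) := by
  have hd0 : (1 : ℝ) ≤ d := by exact_mod_cast hd
  have hx : (2 * d : ℝ) * (1 - 1 / (2 * (d : ℝ))) = ((2 * d - 1 : ℕ) : ℝ) := by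
    rw [Nat.cast_sub (by omega)]
    push_cast
    field_simp
  have hx0 : 0 ≤ 1 - 1 / (2 * (d : ℝ)) := by
    rw [sub_nonneg, div_le_one (by positivity)]
    linarith
  have h1 : (numGroups r d n : ℝ) = (((r ^ (2 * d)) ^ Nat.log (r ^ (2 * d)) n : ℕ) : ℝ) ^
      (1 - 1 / (2 * (d : ℝ))) := by
    rw [rpow_log_pow _ _ _ hx, numGroups, ← pow_mul]
    push_cast
    rfl
  rw [h1]
  refine Real.rpow_le_rpow (Nat.cast_nonneg _) ?_ hx0
  exact_mod_cast Nat.pow_log_le_self (r ^ (2 * d)) (x := n) (by omega)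

theorem one_lt_base (hr : 3 ≤ r) (hd : 1 ≤ d) : 1 < r ^ (2 * d) :=
  Nat.one_lt_pow (by omega) (by omega)

/-- Few edges compared with the number of groups. -/
theorem size_lt (hr : 3 ≤ r) (hd : 1 ≤ d) {s : ℕ}
    (hs : (s : ℝ) < (n : ℝ) ^ (1 + 1 / (2 * (d : ℝ)))) :
    s < numGroups r d n * r ^ (2 * Nat.log (r ^ (2 * d)) n + 2 * d + 1) := by
  have hd0 : (1 : ℝ) ≤ d := by exact_mod_cast hd
  have hx : (2 * d : ℝ) * (1 + 1 / (2 * (d : ℝ))) = ((2 * d + 1 : ℕ) : ℝ) := by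
    push_cast
    field_simp
  set J := Nat.log (r ^ (2 * d)) n with hJ
  have h1 : (n : ℝ) ^ (1 + 1 / (2 * (d : ℝ))) ≤ (r : ℝ) ^ ((2 * d + 1) * (J + 1)) := by
    rw [← rpow_log_pow (J + 1) _ _ hx]
    refine Real.rpow_le_rpow (Nat.cast_nonneg _) ?_ (by positivity)
    exact_mod_cast (Nat.lt_pow_succ_log_self (one_lt_base hr hd) n).le
  have h2 : s < r ^ ((2 * d + 1) * (J + 1)) := by exact_mod_cast hs.trans_le h1
  refine h2.trans_eq ?_
  rw [numGroups, ← hJ, ← pow_mul, ← pow_add]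
  congr 1
  obtain ⟨d, rfl⟩ := Nat.exists_eq_succ_of_ne_zero (by omega : d ≠ 0)
  rw [show 2 * d.succ - 1 = 2 * d + 1 by omega]
  simp only [Nat.succ_eq_add_one]
  ring

/-- log Q = (2d + 1) J log r, while 2d J log r ≤ log n; the factor 3/2 bounds (2d + 1)/(2d). -/
theorem groupSize_pow_le_exp (hr : 3 ≤ r) (hd : 1 ≤ d) (hn : 1 ≤ n) :
    ((groupSize r d n ^ numGroups r d n : ℕ) : ℝ) ≤
      Real.exp (3 / 2 * ((n : ℝ) ^ (1 - 1 / (2 * (d : ℝ))) * Real.log n)) := by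
  have hd0 : (1 : ℝ) ≤ d := by exact_mod_cast hd
  have hn0 : (1 : ℝ) ≤ n := by exact_mod_cast hn
  have hlogn : 0 ≤ Real.log n := Real.log_nonneg hn0
  set J := Nat.log (r ^ (2 * d)) n with hJ
  have hr0 : (0 : ℝ) < r := by exact_mod_cast (by omega : 0 < r)
  have hlogr : 0 ≤ Real.log r := Real.log_nonneg (by exact_mod_cast (by omega : 1 ≤ r))
  have h1 : 2 * d * J * Real.log r ≤ Real.log n := by
    have h := Nat.pow_log_le_self (r ^ (2 * d)) (x := n) (by omega)
    have h' : ((r : ℝ) ^ (2 * d)) ^ J ≤ n := by exact_mod_cast h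
    have h'' := Real.log_le_log (by positivity) h'
    rw [← pow_mul, Real.log_pow] at h''
    push_cast at h''
    exact h''
  have h2 : (2 * d + 1) * J * Real.log r ≤ 3 / 2 * Real.log n := by
    have : (J : ℝ) * Real.log r ≤ d * (J * Real.log r) :=
      le_mul_of_one_le_left (by positivity) hd0
    nlinarith
  have hpos : (0 : ℝ) < ((groupSize r d n ^ numGroups r d n : ℕ) : ℝ) := by
    exact_mod_cast pow_pos (one_le_groupSize hr) _
  rw [← Real.log_le_iff_le_exp hpos]
  push_cast
  rw [Real.log_pow, groupSize, ← hJ]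
  push_cast
  rw [← pow_mul, Real.log_pow]
  push_cast
  calc (numGroups r d n : ℝ) * ((2 * d + 1) * J * Real.log r)
      ≤ (n : ℝ) ^ (1 - 1 / (2 * (d : ℝ))) * (3 / 2 * Real.log n) :=
        mul_le_mul (numGroups_le_rpow hd hn) h2 (by positivity) (by positivity)
    _ = _ := by ring

/-- No group can be encoded by few monomials once there are many groups. -/
theorem not_groupSize_pow_le_choose (hr : 3 ≤ r) (hd : 1 ≤ d)
    (hJ : (6 * r ^ (2 * d + 1)) ^ d ≤ Nat.log (r ^ (2 * d)) n) {s : ℕ}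
    (hs : (s : ℝ) < (n : ℝ) ^ (1 + 1 / (2 * (d : ℝ)))) :
    ¬ groupSize r d n ^ numGroups r d n ≤ (s + d * numGroups r d n).choose (d * numGroups r d n) := by
  intro h
  have hs' := size_lt hr hd hs
  have hT := one_le_numGroups (d := d) (n := n) hr
  set J := Nat.log (r ^ (2 * d)) n with hJ'
  set T := numGroups r d n with hT'
  set M := r ^ (2 * J + 2 * d + 1) with hM
  have hM1 : 1 ≤ M := Nat.one_le_pow _ _ (by omega)
  have hsk : s + d * T ≤ 2 * (d * T * M) := by
    have h1 : T * M ≤ d * T * M := Nat.mul_le_mul_right _ (Nat.le_mul_of_pos_left _ hd)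
    have h2 : d * T ≤ d * T * M := Nat.le_mul_of_pos_right _ hM1
    omega
  have h1 := h.trans (choose_add_le_pow hsk)
  rw [pow_mul] at h1
  -- Take T-th roots.
  have h2 : groupSize r d n ≤ (6 * M) ^ d := le_of_pow_le_pow_left₀ (by omega) (by positivity) h1
  have h3 : groupSize r d n = r ^ J * r ^ (2 * d * J) := by
    rw [groupSize, ← hJ', ← pow_mul, ← pow_add]
    congr 1
    ring
  have h4 : (6 * M) ^ d = (6 * r ^ (2 * d + 1)) ^ d * r ^ (2 * d * J) := by
    rw [hM, show 2 * d * J = (2 * J) * d by ring, pow_mul r (2 * J) d, ← mul_pow, mul_assoc,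
      ← pow_add]
    congr 3
    ring
  rw [h3, h4] at h2
  -- Cancelling r^(2dJ) leaves r^J ≤ (6 r^(2d+1))^d ≤ J, which is absurd.
  have h5 := Nat.le_of_mul_le_mul_right h2 (pow_pos (by omega) _)
  have h6 : J < r ^ J := Nat.lt_pow_self (by omega)
  omega

end Parameters

/-! ### Asymptotics of the running time and of the degree. -/

/-- A bound for all counters that occur in the construction. -/
def counterBound (r d m n : ℕ) : ℕ :=
  (20 + r ^ (2 * d) * r ^ (2 * d) + r ^ (2 * d - 1) + r ^ (2 * d + 1) + m + 1) + n +
    (r ^ (2 * d)) ^ (Nat.log (r ^ (2 * d)) n + 1) + numGroups r d n + groupSize r d n +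
    m * groupSize r d n ^ numGroups r d n

/-- With L = n^(1-1/(2d)) log n, every summand but the last is O(n²), and n² ≤ exp(2L) since log n ≤
L; the last is deg f · Q^T. -/
theorem counterBound_le {r d m : ℕ} (hr : 3 ≤ r) (hd : 1 ≤ d) :
    ∃ K : ℝ, 1 ≤ K ∧ ∀ n : ℕ, 1 ≤ n → (counterBound r d m n : ℝ) ≤
      K * Real.exp (2 * ((n : ℝ) ^ (1 - 1 / (2 * (d : ℝ))) * Real.log n)) := by
  set c₀ := 20 + r ^ (2 * d) * r ^ (2 * d) + r ^ (2 * d - 1) + r ^ (2 * d + 1) + m + 1 with hc₀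
  refine ⟨((c₀ + r ^ (2 * d) + 3 + m : ℕ) : ℝ), by exact_mod_cast (by omega), fun n hn => ?_⟩
  have hd0 : (1 : ℝ) ≤ d := by exact_mod_cast hd
  have hn0 : (1 : ℝ) ≤ n := by exact_mod_cast hn
  have hlogn : 0 ≤ Real.log n := Real.log_nonneg hn0
  set L := (n : ℝ) ^ (1 - 1 / (2 * (d : ℝ))) * Real.log n with hL
  have hx0 : 0 ≤ 1 - 1 / (2 * (d : ℝ)) := by
    rw [sub_nonneg, div_le_one (by positivity)]
    linarith
  have hlogL : Real.log n ≤ L := le_mul_of_one_le_left hlogn (Real.one_le_rpow hn0 hx0)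
  have hn2 : ((n * n : ℕ) : ℝ) ≤ Real.exp (2 * L) := by
    rw [← Real.log_le_iff_le_exp (by positivity)]
    push_cast
    rw [Real.log_mul (by positivity) (by positivity)]
    linarith
  have hP : ((groupSize r d n ^ numGroups r d n : ℕ) : ℝ) ≤ Real.exp (2 * L) := by
    refine (groupSize_pow_le_exp hr hd hn).trans (Real.exp_le_exp.mpr ?_)
    linarith
  have hTQ := numGroups_mul_groupSize_le (r := r) hd hn
  have hT1 := one_le_numGroups (d := d) (n := n) hr
  have hQ1 := one_le_groupSize (d := d) (n := n) hr
  have hT : numGroups r d n ≤ n * n := (Nat.le_mul_of_pos_right _ hQ1).trans hTQ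
  have hQ : groupSize r d n ≤ n * n := (Nat.le_mul_of_pos_left _ hT1).trans hTQ
  have hnn : n ≤ n * n := Nat.le_mul_of_pos_left _ hn
  have hb : (r ^ (2 * d)) ^ (Nat.log (r ^ (2 * d)) n + 1) ≤ r ^ (2 * d) * (n * n) := by
    rw [pow_succ']
    exact Nat.mul_le_mul_left _ ((Nat.pow_log_le_self _ (by omega)).trans hnn)
  have h0 : c₀ ≤ c₀ * (n * n) := Nat.le_mul_of_pos_right _ (by nlinarith)
  have hB : counterBound r d m n ≤
      (c₀ + r ^ (2 * d) + 3) * (n * n) + m * groupSize r d n ^ numGroups r d n := by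
    rw [counterBound, ← hc₀]
    have : (c₀ + r ^ (2 * d) + 3) * (n * n) =
      c₀ * (n * n) + r ^ (2 * d) * (n * n) + 3 * (n * n) := by ring
    omega
  calc (counterBound r d m n : ℝ)
      ≤ ((c₀ + r ^ (2 * d) + 3 : ℕ) : ℝ) * ((n * n : ℕ) : ℝ) +
        (m : ℝ) * ((groupSize r d n ^ numGroups r d n : ℕ) : ℝ) := by exact_mod_cast hB
    _ ≤ ((c₀ + r ^ (2 * d) + 3 : ℕ) : ℝ) * Real.exp (2 * L) + (m : ℝ) * Real.exp (2 * L) := by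
        gcongr
    _ = _ := by
        push_cast
        ring

-- B^13 contributes 26 L to the exponent. Eventually L ≤ E/52 for E = n^(1-1/(4d)), because log n =
-- o(n^(1/(4d))); so this takes half of E, and the constants fit into the other half.
open Filter in
theorem eventually_time_le {d : ℕ} (hd : 1 ≤ d) {K : ℝ} (hK : 1 ≤ K) {B : ℕ → ℕ}
    (hB : ∀ n : ℕ, 1 ≤ n → (B n : ℝ) ≤
      K * Real.exp (2 * ((n : ℝ) ^ (1 - 1 / (2 * (d : ℝ))) * Real.log n))) :
    ∀ᶠ n : ℕ in atTop, ((B n ^ 13 + 1 : ℕ) : ℝ) ≤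
      Real.exp ((n : ℝ) ^ (1 - (1 / 4) / (d : ℝ))) := by
  have hd0 : (1 : ℝ) ≤ d := by exact_mod_cast hd
  have h1 : ∀ᶠ n : ℕ in atTop, Real.log n ≤ 1 / 52 * (n : ℝ) ^ ((1 / 4) / (d : ℝ)) := by
    have h := (isLittleO_log_rpow_atTop (r := (1 / 4) / (d : ℝ)) (by positivity)).def
      (c := 1 / 52) (by norm_num)
    filter_upwards [tendsto_natCast_atTop_atTop.eventually h, eventually_ge_atTop 1] with n hn hn1
    have hn0 : (1 : ℝ) ≤ n := by exact_mod_cast hn1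
    rw [Real.norm_of_nonneg (Real.log_nonneg hn0), Real.norm_of_nonneg (by positivity)] at hn
    exact hn
  have hexp : 0 < 1 - (1 / 4) / (d : ℝ) := by
    rw [sub_pos, div_lt_one (by positivity)]
    linarith
  have h2 : ∀ᶠ n : ℕ in atTop, 2 * (13 * Real.log K + Real.log 2) ≤
      (n : ℝ) ^ (1 - (1 / 4) / (d : ℝ)) :=
    ((tendsto_rpow_atTop hexp).comp tendsto_natCast_atTop_atTop).eventually_ge_atTop _
  filter_upwards [h1, h2, eventually_ge_atTop 1] with n h1 h2 hn
  have hn0 : (1 : ℝ) ≤ n := by exact_mod_cast hn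
  set L := (n : ℝ) ^ (1 - 1 / (2 * (d : ℝ))) * Real.log n with hL
  set E := (n : ℝ) ^ (1 - (1 / 4) / (d : ℝ)) with hE
  have hlogn : 0 ≤ Real.log n := Real.log_nonneg hn0
  have hL0 : 0 ≤ L := by positivity
  have hLE : L ≤ 1 / 52 * E := by
    calc L ≤ (n : ℝ) ^ (1 - 1 / (2 * (d : ℝ))) * (1 / 52 * (n : ℝ) ^ ((1 / 4) / (d : ℝ))) := by
          rw [hL]
          gcongr
      _ = 1 / 52 * ((n : ℝ) ^ (1 - 1 / (2 * (d : ℝ))) * (n : ℝ) ^ ((1 / 4) / (d : ℝ))) := by ring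
      _ = 1 / 52 * E := by
          rw [← Real.rpow_add (by positivity), hE]
          congr 2
          field_simp
          ring
  have hX : 1 ≤ K * Real.exp (2 * L) := by
    have := Real.one_le_exp (by positivity : 0 ≤ 2 * L)
    nlinarith
  calc ((B n ^ 13 + 1 : ℕ) : ℝ) = (B n : ℝ) ^ 13 + 1 := by push_cast; ring
    _ ≤ (K * Real.exp (2 * L)) ^ 13 + (K * Real.exp (2 * L)) ^ 13 := by
        gcongr
        · exact hB n hn
        · exact one_le_pow₀ hX
    _ = 2 * (K * Real.exp (2 * L)) ^ 13 := by ring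
    _ = Real.exp (Real.log 2 + 13 * (Real.log K + 2 * L)) := by
        rw [Real.exp_add, Real.exp_log (by norm_num), show (13 : ℝ) = ((13 : ℕ) : ℝ) by norm_num,
          Real.exp_nat_mul, Real.exp_add, Real.exp_log (by linarith)]
    _ ≤ Real.exp E := by
        apply Real.exp_le_exp.mpr
        linarith

-- The constant factor m is absorbed into exp(L/2), the gap between the exponents 3/2 and 2.
open Filter in
theorem eventually_degree_le {r d : ℕ} (m : ℕ) (hr : 3 ≤ r) (hd : 1 ≤ d) :
    ∀ᶠ n : ℕ in atTop, ((m * groupSize r d n ^ numGroups r d n : ℕ) : ℝ) ≤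
      Real.exp (2 * ((n : ℝ) ^ (1 - 1 / (2 * (d : ℝ))) * Real.log n)) := by
  have hd0 : (1 : ℝ) ≤ d := by exact_mod_cast hd
  have h1 : ∀ᶠ n : ℕ in atTop, (2 * m : ℝ) ≤ Real.log n :=
    (Real.tendsto_log_atTop.comp tendsto_natCast_atTop_atTop).eventually_ge_atTop _
  filter_upwards [h1, eventually_ge_atTop 1] with n h1 hn
  have hn0 : (1 : ℝ) ≤ n := by exact_mod_cast hn
  have hlogn : 0 ≤ Real.log n := Real.log_nonneg hn0
  set L := (n : ℝ) ^ (1 - 1 / (2 * (d : ℝ))) * Real.log n with hL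
  have hx0 : 0 ≤ 1 - 1 / (2 * (d : ℝ)) := by
    rw [sub_nonneg, div_le_one (by positivity)]
    linarith
  have hlogL : Real.log n ≤ L := le_mul_of_one_le_left hlogn (Real.one_le_rpow hn0 hx0)
  have hm : (m : ℝ) ≤ Real.exp (1 / 2 * L) := by
    have := Real.add_one_le_exp (1 / 2 * L)
    linarith
  calc ((m * groupSize r d n ^ numGroups r d n : ℕ) : ℝ)
      = m * ((groupSize r d n ^ numGroups r d n : ℕ) : ℝ) := by push_cast; ring
    _ ≤ Real.exp (1 / 2 * L) * Real.exp (3 / 2 * L) := by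
        gcongr
        exact groupSize_pow_le_exp hr hd hn
    _ = Real.exp (2 * L) := by
        rw [← Real.exp_add]
        congr 1
        ring

/-! ### Assembling the theorem. -/

/-- Every exponent `c * Q ^ g` occurs in the matrix. -/
theorem exists_entry_eq {F : Type} [Field F] {f : F[X]} (hf : f.Monic) {T Q n : ℕ} (hQ : 1 ≤ Q)
    (hirr : Irreducible (expand F (Q ^ T) f)) (hTQ : T * Q ≤ n * n) {c g : ℕ} (hc : c < Q)
    (hg : g < T) : ∃ i j, (powerMatrix f hf T Q hQ hirr n).entries i j =
      AdjoinRoot.root (powerMatrix f hf T Q hQ hirr n).modulus ^ (c * Q ^ g) := by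
  have hk : g * Q + c < n * n := by
    have : (g + 1) * Q ≤ T * Q := Nat.mul_le_mul_right _ hg
    rw [add_mul, one_mul] at this
    omega
  have hn : 0 < n := Nat.pos_of_ne_zero fun h => by simp [h] at hk
  set y := n * n - 1 - (g * Q + c) with hy
  refine ⟨⟨y / n, by rw [Nat.div_lt_iff_lt_mul hn]; omega⟩, ⟨y % n, Nat.mod_lt _ hn⟩, ?_⟩
  change AdjoinRoot.root _ ^ expo T Q (n * n - 1 - (y / n * n + y % n)) = _
  rw [Nat.div_add_mod', show n * n - 1 - y = c + Q * g by rw [mul_comm Q]; omega, expo,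
    Nat.add_mul_mod_self_left, Nat.mod_eq_of_lt hc, Nat.add_mul_div_left _ _ hQ,
    Nat.div_eq_of_lt hc, zero_add, place, if_pos hg]
  rfl

/-- `counterBound` sums all quantities that the program must keep below B, so the side conditions
become linear arithmetic. -/
theorem constructible_powerMatrix {F : Type} [Field F] {f : F[X]} (hf : f.Monic)
    (hdeg : 1 ≤ f.natDegree) {r d : ℕ} (hr : 3 ≤ r) (hd : 1 ≤ d)
    (hirr : ∀ n, Irreducible (expand F (groupSize r d n ^ numGroups r d n) f)) :
    ConstructibleInTime (fun n => powerMatrix f hf (numGroups r d n) (groupSize r d n)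
      (one_le_groupSize hr) (hirr n) n)
      (fun n => counterBound r d f.natDegree n ^ 13 + 1) := by
  have hlen : (lowerCoeffs f).length = f.natDegree := by simp [lowerCoeffs]
  refine exists_computableInTime (matrixProg (r ^ (2 * d)) (r ^ (2 * d - 1)) (r ^ (2 * d + 1))
    (some 0) (some 1) none (lowerCoeffs f)) Reg.n _ _ fun n => ?_
  rw [encode_powerMatrix hf _ _ hdeg]
  have hb := one_lt_base hr hd
  have hb' : r ^ (2 * d) + r ^ (2 * d) * (r ^ (2 * d) - 1) = r ^ (2 * d) * r ^ (2 * d) := by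
    rw [Nat.mul_sub, mul_one]
    have := Nat.le_mul_self (r ^ (2 * d))
    omega
  have hB : counterBound r d f.natDegree n = (20 + r ^ (2 * d) * r ^ (2 * d) + r ^ (2 * d - 1) +
    r ^ (2 * d + 1) + f.natDegree + 1) + n +
    (r ^ (2 * d)) ^ (Nat.log (r ^ (2 * d)) n + 1) + (r ^ (2 * d - 1)) ^ Nat.log (r ^ (2 * d)) n +
    (r ^ (2 * d + 1)) ^ Nat.log (r ^ (2 * d)) n + f.natDegree *
      ((r ^ (2 * d + 1)) ^ Nat.log (r ^ (2 * d)) n) ^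
        ((r ^ (2 * d - 1)) ^ Nat.log (r ^ (2 * d)) n) := rfl
  refine runs_matrixProg (B := counterBound r d f.natDegree n) _ _ _ _ ?_ hb ?_ ?_ ?_
    (Nat.one_le_pow _ _ (by omega)) (Nat.one_le_pow _ _ (by omega)) ?_ ?_ ?_ ?_ ?_ (hlen.symm ▸ hdeg) ?_ <;>
    (try rw [hlen]) <;> omega

/-- The image of the root under an F-embedding still has the modulus as minimal polynomial, of
degree at least Q^T, so the dimension argument applies in K. -/
theorem lower_bound_powerMatrix {F : Type} [Field F] {f : F[X]} (hf : f.Monic)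
    (hdeg : 1 ≤ f.natDegree) {r d n : ℕ} (hr : 3 ≤ r) (hd : 1 ≤ d) (hn : 1 ≤ n)
    (hJ : (6 * r ^ (2 * d + 1)) ^ d ≤ Nat.log (r ^ (2 * d)) n)
    (hirr : Irreducible (expand F (groupSize r d n ^ numGroups r d n) f))
    {K : Type} [Field K] [Algebra F K]
    (φ : (powerMatrix f hf (numGroups r d n) (groupSize r d n) (one_le_groupSize hr) hirr n).Ext
      →ₐ[F] K)
    (C : LinearCircuit K n) (hC : C.DepthAtMost d)
    (h : C.Computes ((powerMatrix f hf (numGroups r d n) (groupSize r d n)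
      (one_le_groupSize hr) hirr n).entries.map φ)) :
    (n : ℝ) ^ (1 + 1 / (2 * (d : ℝ))) ≤ (C.size : ℝ) := by
  by_contra hlt
  let A := powerMatrix f hf (numGroups r d n) (groupSize r d n) (one_le_groupSize hr) hirr n
  have hmin : minpoly F (φ (AdjoinRoot.root A.modulus)) = A.modulus := by
    refine (minpoly.eq_of_irreducible_of_monic A.irreducible ?_ A.monic).symm
    rw [aeval_algHom_apply, AdjoinRoot.aeval_eq, AdjoinRoot.mk_self, map_zero]
  have hnd : A.modulus.natDegree = f.natDegree * groupSize r d n ^ numGroups r d n :=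
    natDegree_expand _ _
  refine not_groupSize_pow_le_choose hr hd hJ (not_le.mp hlt)
    (h.pow_le_choose (F := F) hC (φ (AdjoinRoot.root A.modulus)) ?_ fun c hc g hg => ?_)
  · rw [hmin, hnd]
    exact Nat.le_mul_of_pos_left _ hdeg
  · obtain ⟨i, j, hij⟩ := exists_entry_eq hf (one_le_groupSize hr) hirr
      (numGroups_mul_groupSize_le hd hn) hc hg
    exact ⟨i, j, (congrArg φ hij).trans (map_pow φ _ _)⟩

theorem mainTheorem6 :
    ∃ C c δ : ℝ, 0 < C ∧ 0 < c ∧ 0 < δ ∧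
      ∀ (F : Type) [Field F] [Finite F] (d : ℕ), 1 ≤ d →
        ∃ A : (n : ℕ) → ExtensionMatrix F n,
          (∀ᶠ n : ℕ in Filter.atTop,
            (Module.finrank F (A n).Ext : ℝ) ≤
              Real.exp (C * ((n : ℝ) ^ (1 - 1 / (2 * (d : ℝ))) * Real.log n))) ∧
          (∃ T : ℕ → ℕ, ConstructibleInTime A T ∧
            ∀ᶠ n : ℕ in Filter.atTop,
              (T n : ℝ) ≤ Real.exp ((n : ℝ) ^ (1 - c / (d : ℝ)))) ∧
          (∀ᶠ n : ℕ in Filter.atTop,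
            ∀ (φ : (A n).Ext →ₐ[F] AlgebraicClosure F)
              (circ : LinearCircuit (AlgebraicClosure F) n),
              circ.DepthAtMost d → circ.Computes ((A n).entries.map φ) →
                δ * (n : ℝ) ^ (1 + 1 / (2 * (d : ℝ))) ≤ (circ.size : ℝ)) := by
  refine ⟨2, 1 / 4, 1, by norm_num, by norm_num, by norm_num, fun F _ _ d hd => ?_⟩
  obtain ⟨r, f, -, hr, hf, hirr⟩ := exists_irreducible_expand_prime_pow F
  have hdeg : 1 ≤ f.natDegree := by
    have h := hirr 0
    rw [pow_zero, expand_one] at h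
    exact h.natDegree_pos
  -- Q^T is a power of r.
  have hirr' : ∀ n, Irreducible (expand F (groupSize r d n ^ numGroups r d n) f) := fun n => by
    rw [groupSize, ← pow_mul, ← pow_mul]
    exact hirr _
  refine ⟨fun n => powerMatrix f hf (numGroups r d n) (groupSize r d n) (one_le_groupSize hr)
    (hirr' n) n, ?_, ⟨_, constructible_powerMatrix hf hdeg hr hd hirr', ?_⟩, ?_⟩
  · filter_upwards [eventually_degree_le f.natDegree hr hd] with n hn
    convert hn using 2
    exact (AdjoinRoot.powerBasis (hirr' n).ne_zero).finrank.trans (natDegree_expand _ _)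
  · obtain ⟨K, hK, hB⟩ := counterBound_le (m := f.natDegree) hr hd
    exact eventually_time_le hd hK hB
  · have hlog : ∀ᶠ n : ℕ in Filter.atTop,
        (6 * r ^ (2 * d + 1)) ^ d ≤ Nat.log (r ^ (2 * d)) n := by
      filter_upwards [Filter.eventually_ge_atTop ((r ^ (2 * d)) ^ (6 * r ^ (2 * d + 1)) ^ d)] with
        n hn
      exact Nat.le_log_of_pow_le (one_lt_base hr hd) hn
    filter_upwards [hlog, Filter.eventually_ge_atTop 1] with n hJ hn φ circ hcd hcomp
    rw [one_mul]
    exact lower_bound_powerMatrix hf hdeg hr hd hn hJ (hirr' n) φ circ hcd hcomp
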